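/- For a complex number $q$ with $|q|<1$ put $(q;q)_n:=\prod_{k=1}^{n}(1-q^k)$ and $$E(q):=\sum_{n=-\infty}^{\infty}(-1)^nq^{n(3n-1)/2}=\prod_{n\ge1}(1-q^n),\qquad G(q):=\sum_{n\ge0}\frac{q^{n^2}}{(q;q)_n},\qquad H(q):=\sum_{n\ge0}\frac{q^{n(n+1)}}{(q;q)_n}.$$ For positive integers $r,s$ let $$U(r,s,q):=\begin{cases}G(q^r)G(q^s)+q^{(s+r)/5}H(q^r)H(q^s)&\text{if } s+r\equiv0\pmod 5,\\ H(q^r)G(q^s)-q^{(s-r)/5}G(q^r)H(q^s)&\text{if } s-r\equiv0\pmod 5,\end{cases}$$ and for a positive definite binary quadratic form $an^2+bnm+cm^2$ with integer coefficients write $(a,b,c)$ for its generating function $\sum_{n,m=-\infty}^{\infty}q^{an^2+bnm+cm^2}$. **Theorem.** Let $Q:=q^{13}$. For all complex $q$ with $|q|<1$, $$(2,1,44)-(8,1,11)=2q^2E(q^9)E(Q^3),$$ $$(5,3,18)-(8,1,11)=2q^5E(q^3)E(Q^9),$$ $$(4,1,22)-(10,7,10)=2q^4E(q^9)E(Q^3)\,U(3,13,q^3)^2,$$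 $$(1,1,88)-(9,3,10)=2q\,E(q^3)E(Q^9)\,U(1,39,q^3)^2.$$ Moreover $$\frac{(4,1,22)-(10,7,10)}{(1,1,88)-(9,3,10)}=\frac{(5,3,18)-(8,1,11)}{(2,1,44)-(8,1,11)}=q^3\,\frac{E(q^3)E(Q^9)}{E(q^9)E(Q^3)}$$ as meromorphic functions on $|q|<1$. More precisely, $(2,1,44)-(8,1,11)$ and $E(q^9)E(Q^3)$ have no zeros in $0<|q|<1$, and the second equality holds at every such $q$; the zeros of $(1,1,88)-(9,3,10)$ in $|q|<1$ form a set without accumulation points in $|q|<1$, and the first equality holds at every $q$ with $0<|q|<1$ outside this set. -/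

import Mathlib

noncomputable section

/-- Ramanujan's general theta function
`f(a,b) = ∑_{n ∈ ℤ} a^{n(n+1)/2} b^{n(n-1)/2}`, `|ab| < 1`. -/
def ramanujanTheta (a b : ℂ) : ℂ :=
  ∑' n : ℤ, a ^ (n * (n + 1) / 2) * b ^ (n * (n - 1) / 2)

/-- `E(q) = f(-q,-q²) = ∑_{n ∈ ℤ} (-1)^n q^{n(3n-1)/2} = (q;q)_∞`. -/
def eulerE (q : ℂ) : ℂ := ramanujanTheta (-q) (-q ^ 2)

/-- The finite `q`-shifted factorial `(a;q)_n = ∏_{k=0}^{n-1} (1 - a q^k)`. -/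
def qShiftedFactorial (a q : ℂ) (n : ℕ) : ℂ := ∏ k ∈ Finset.range n, (1 - a * q ^ k)

/-- The Rogers-Ramanujan function `G(q) = ∑_{n ≥ 0} q^{n²} / (q;q)_n`. -/
def rogersG (q : ℂ) : ℂ := ∑' n : ℕ, q ^ (n ^ 2) / qShiftedFactorial q q n

/-- The Rogers-Ramanujan function `H(q) = ∑_{n ≥ 0} q^{n(n+1)} / (q;q)_n`. -/
def rogersH (q : ℂ) : ℂ := ∑' n : ℕ, q ^ (n * (n + 1)) / qShiftedFactorial q q n

/-- Ramanujan's function `U(r,s,q)`, meant for positive `r`, `s` with `r + s ≡ 0 (mod 5)` (first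
formula) or `s - r ≡ 0 (mod 5)` (second formula). -/
def rogersU (r s : ℕ) (q : ℂ) : ℂ :=
  if (r + s) % 5 = 0 then
    rogersG (q ^ r) * rogersG (q ^ s) + q ^ ((s + r) / 5) * rogersH (q ^ r) * rogersH (q ^ s)
  else
    rogersH (q ^ r) * rogersG (q ^ s)
      - q ^ (((s : ℤ) - (r : ℤ)) / 5) * rogersG (q ^ r) * rogersH (q ^ s)

/-- The generating function `(a,b,c) = ∑_{n,m ∈ ℤ} q^{a n² + b n m + c m²}` of a positive definite
binary quadratic form. -/
def formSeries (a b c : ℤ) (q : ℂ) : ℂ :=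
  ∑' p : ℤ × ℤ, q ^ (a * p.1 ^ 2 + b * p.1 * p.2 + c * p.2 ^ 2)

end

/-! All seven forms in the theorem have discriminant −351. The link with Euler's function is that A
+ B = 8c implies 8(cn² + Ant + 2At²) = A(n+4t)² + Bn². Completing squares in the pentagonal series
turns q^c E(q^(3A)) E(q^(3B)) into a signed sum over n = 6b−1, n+4t = ±(6a−1), and the sign tells
the sublattice 3 ∣ t from 3 ∣ t−n. So twice the product is a difference of two form series
(`formSeries_sub_eq_eulerE_mul`); (A,B,c) = (3,13,2) and (1,39,5) give the first two identities.

The other two are the images of these under the Hecke operator T₅. On form series, T₅ sends a class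
to the sum of two classes (`sum_rotate_formSeries_add`), and (9,3,10) or (4,1,22) cancels in the
difference. On the Euler side the 5-dissection E(p) = E(p⁵)(G² − pGH − p²H²), with G, H taken at p⁵
(`eulerE_eq_rogers`), makes the average over fifth roots of unity explicit. The remaining term of
T₅, at p²⁵, is rewritten by G(q)H(q)E(q) = E(q⁵) and completes a perfect square, the square of U.
The dissection rests on the triple and quintuple product identities and on the Rogers–Ramanujan
identities, proved here by Bailey's lemma.

For the quotients, what is needed is E(q⁹)E(q³⁹)U(3,13,q³) = E(q³)E(q¹¹⁷)U(1,39,q³). With q in place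
of q³, each side times 2q is the difference (1,1,10) − (3,3,4) of discriminant −39, computed by the
same completion of squares with 10 in place of 6 (`formSeries_sub_eq_tsum_residues`,
`tsum_residue_eq_jacobiSeries_mul`). The zeros of (1,1,88) − (9,3,10) are isolated by the identity
theorem, since G and H are positive on (0,1). -/

open Filter Topology

/-! ### Infinite q-products and reciprocal q-factorials -/

/-- The infinite `q`-shifted factorial `(a;q)_∞ = ∏_{k ≥ 0} (1 - a q^k)`. -/
noncomputable def qShiftedFactorialInf (a q : ℂ) : ℂ := ∏' k : ℕ, (1 - a * q ^ k)

theorem summable_norm_mul_pow {q : ℂ} (hq : ‖q‖ < 1) (a : ℂ) :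
    Summable fun k : ℕ => ‖-(a * q ^ k)‖ := by
  simp only [norm_neg, norm_mul, norm_pow]
  exact (summable_geometric_of_lt_one (norm_nonneg q) hq).mul_left _

theorem tendsto_qShiftedFactorial {q : ℂ} (hq : ‖q‖ < 1) (a : ℂ) :
    Tendsto (qShiftedFactorial a q) atTop (𝓝 (qShiftedFactorialInf a q)) := by
  have h := (multipliable_one_add_of_summable (summable_norm_mul_pow hq a)).hasProd.tendsto_prod_nat
  simp only [← sub_eq_add_neg] at h
  exact h

theorem one_sub_pow_ne_zero {q : ℂ} (hq : ‖q‖ < 1) {n : ℕ} (hn : n ≠ 0) : 1 - q ^ n ≠ 0 := by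
  intro h
  have h1 : ‖q ^ n‖ = 1 := by rw [← sub_eq_zero.mp h]; simp
  rw [norm_pow] at h1
  exact (pow_lt_one₀ (norm_nonneg q) hq hn).ne h1

theorem qShiftedFactorialInf_ne_zero {q : ℂ} (hq : ‖q‖ < 1) {m : ℕ} (hm : m ≠ 0) :
    qShiftedFactorialInf (q ^ m) q ≠ 0 := by
  have h := tprod_one_add_ne_zero_of_summable (f := fun k : ℕ => -(q ^ m * q ^ k))
    (fun k => by
      rw [← sub_eq_add_neg, ← pow_add]
      exact one_sub_pow_ne_zero hq (by omega)) (summable_norm_mul_pow hq _)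
  simp only [← sub_eq_add_neg] at h
  exact h

theorem qShiftedFactorial_self_ne_zero {q : ℂ} (hq : ‖q‖ < 1) (n : ℕ) :
    qShiftedFactorial q q n ≠ 0 := by
  refine Finset.prod_ne_zero_iff.mpr fun k _ => ?_
  rw [← pow_succ']
  exact one_sub_pow_ne_zero hq (by omega)

theorem qShiftedFactorial_succ (a q : ℂ) (n : ℕ) :
    qShiftedFactorial a q (n + 1) = qShiftedFactorial a q n * (1 - a * q ^ n) :=
  Finset.prod_range_succ _ _

/-- `1 / (q;q)_n`, extended by zero to negative `n`. -/
noncomputable def invQFactorial (q : ℂ) (n : ℤ) : ℂ :=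
  if n < 0 then 0 else (qShiftedFactorial q q n.toNat)⁻¹

theorem invQFactorial_of_neg (q : ℂ) {n : ℤ} (hn : n < 0) : invQFactorial q n = 0 := if_pos hn

theorem invQFactorial_natCast (q : ℂ) (n : ℕ) :
    invQFactorial q n = (qShiftedFactorial q q n)⁻¹ := by
  simp [invQFactorial]

theorem invQFactorial_zero (q : ℂ) : invQFactorial q 0 = 1 := by
  simp [invQFactorial, qShiftedFactorial]

/-- Extension by zero keeps the recurrence valid at every integer (at n = 0 both sides vanish), so
the bilateral sums below have no boundary terms. -/
theorem one_sub_zpow_mul_invQFactorial {q : ℂ} (hq : ‖q‖ < 1) (n : ℤ) :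
    (1 - q ^ n) * invQFactorial q n = invQFactorial q (n - 1) := by
  rcases lt_trichotomy n 0 with h | rfl | h
  · rw [invQFactorial_of_neg q h, invQFactorial_of_neg q (by omega), mul_zero]
  · rw [invQFactorial_of_neg q (n := 0 - 1) (by omega)]; simp
  · obtain ⟨m, rfl⟩ : ∃ m : ℕ, n = m + 1 := ⟨(n - 1).toNat, by omega⟩
    rw [add_sub_cancel_right, invQFactorial_natCast]
    have := invQFactorial_natCast q (m + 1)
    push_cast at this
    rw [this, qShiftedFactorial_succ, ← pow_succ']
    have h1 := qShiftedFactorial_self_ne_zero hq m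
    have h2 := one_sub_pow_ne_zero hq (n := m + 1) (by omega)
    have h3 : q ^ ((m : ℤ) + 1) = q ^ (m + 1) := by exact_mod_cast zpow_natCast q (m + 1)
    rw [h3]
    field_simp

theorem tendsto_invQFactorial_natCast {q : ℂ} (hq : ‖q‖ < 1) :
    Tendsto (fun n : ℕ => invQFactorial q n) atTop (𝓝 (qShiftedFactorialInf q q)⁻¹) := by
  simp only [invQFactorial_natCast]
  have h := qShiftedFactorialInf_ne_zero hq one_ne_zero
  rw [pow_one] at h
  exact (tendsto_qShiftedFactorial hq q).inv₀ h

theorem tendsto_invQFactorial {q : ℂ} (hq : ‖q‖ < 1) :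
    Tendsto (invQFactorial q) atTop (𝓝 (qShiftedFactorialInf q q)⁻¹) := by
  have h := (tendsto_invQFactorial_natCast hq).comp
    (tendsto_atTop_atTop.mpr fun b : ℕ => ⟨(b : ℤ), fun a ha => by
      show b ≤ a.toNat
      omega⟩ : Tendsto Int.toNat atTop atTop)
  refine h.congr' ?_
  filter_upwards [eventually_ge_atTop (0 : ℤ)] with n hn
  simp [Int.toNat_of_nonneg hn]

theorem exists_norm_invQFactorial_le {q : ℂ} (hq : ‖q‖ < 1) :
    ∃ M : ℝ, 0 ≤ M ∧ ∀ n : ℤ, ‖invQFactorial q n‖ ≤ M := by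
  obtain ⟨M, hM⟩ := (tendsto_invQFactorial_natCast hq).norm.bddAbove_range
  have hM' : ∀ n : ℕ, ‖invQFactorial q n‖ ≤ M := fun n => hM ⟨n, rfl⟩
  have h0 : 0 ≤ M := (norm_nonneg _).trans (hM' 0)
  refine ⟨M, h0, fun n => ?_⟩
  rcases lt_or_ge n 0 with h | h
  · rw [invQFactorial_of_neg q h, norm_zero]; exact h0
  · obtain ⟨m, rfl⟩ := Int.eq_ofNat_of_zero_le h
    exact hM' m

/-! ### The q-binomial theorem and Jacobi's triple product -/

theorem two_mul_ediv_mul_sub_one (n : ℤ) : 2 * (n * (n - 1) / 2) = n * (n - 1) :=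
  Int.mul_ediv_cancel' (by simpa using Int.even_mul_pred_self n |>.two_dvd)

theorem two_mul_ediv_mul_add_one (n : ℤ) : 2 * (n * (n + 1) / 2) = n * (n + 1) :=
  Int.mul_ediv_cancel' (Int.even_mul_succ_self n).two_dvd

theorem summable_pow_mul_pow_choose {q : ℂ} (hq : ‖q‖ < 1) (w : ℂ) :
    Summable fun n : ℕ => w ^ n * q ^ n.choose 2 := by
  by_cases h : w = 0 ∨ q = 0
  · refine summable_of_ne_finset_zero (s := Finset.range 2) fun n hn => ?_
    simp only [Finset.mem_range, not_lt] at hn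
    rcases h with rfl | rfl
    · rw [zero_pow (by omega), zero_mul]
    · rw [zero_pow (Nat.choose_pos hn).ne', mul_zero]
  · push Not at h
    refine summable_of_ratio_test_tendsto_lt_one (l := 0) one_pos
      (Eventually.of_forall fun n => mul_ne_zero (pow_ne_zero _ h.1) (pow_ne_zero _ h.2)) ?_
    have h1 : ∀ n : ℕ, ‖w‖ * ‖q‖ ^ n =
        ‖w ^ (n + 1) * q ^ (n + 1).choose 2‖ / ‖w ^ n * q ^ n.choose 2‖ := fun n => by
      have hw := norm_ne_zero_iff.mpr h.1
      have hq := norm_ne_zero_iff.mpr h.2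
      have h2 : (n + 1).choose 2 = n + n.choose 2 := by
        rw [Nat.choose_succ_succ' n 1, Nat.choose_one_right]
      simp only [norm_mul, norm_pow, h2, pow_add, pow_one]
      field_simp
    simp only [← h1]
    simpa using (tendsto_pow_atTop_nhds_zero_of_lt_one (norm_nonneg q) hq).const_mul ‖w‖

/-- The negative half of the series is the positive half with w replaced by q/w. -/
theorem summable_zpow_mul_zpow {q : ℂ} (hq0 : q ≠ 0) (hq : ‖q‖ < 1) (w : ℂ) :
    Summable fun n : ℤ => w ^ n * q ^ (n * (n - 1) / 2) := by
  have hc : ∀ n : ℕ, (n : ℤ) * (n - 1) / 2 = (n.choose 2 : ℕ) := fun n => by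
    have h1 : (n.choose 2 : ℤ) * 2 = n * (n - 1) := by
      induction n with
      | zero => simp
      | succ n ih =>
        rw [Nat.choose_succ_succ' n 1, Nat.choose_one_right]
        push_cast
        linear_combination ih
    have := two_mul_ediv_mul_sub_one n
    omega
  refine Summable.of_nat_of_neg ?_ ?_
  · refine (summable_pow_mul_pow_choose hq w).congr fun n => ?_
    rw [hc, zpow_natCast, zpow_natCast]
  · refine (summable_pow_mul_pow_choose hq (q * w⁻¹)).congr fun n => ?_
    have h2 : (-(n : ℤ)) * (-(n : ℤ) - 1) / 2 = n + (n.choose 2 : ℕ) := by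
      rw [← hc]
      have h3 := two_mul_ediv_mul_sub_one n
      have h4 := two_mul_ediv_mul_sub_one (-(n : ℤ))
      have h5 : (-(n : ℤ)) * (-(n : ℤ) - 1) = n * (n - 1) + 2 * n := by ring
      omega
    rw [h2, zpow_add₀ hq0, zpow_natCast, zpow_natCast, zpow_neg, zpow_natCast, mul_pow, inv_pow]
    ring

theorem summable_of_eq_zero_off_Icc {f : ℤ → ℂ} (a b : ℤ) (h : ∀ k, k < a ∨ b < k → f k = 0) :
    Summable f :=
  summable_of_ne_finset_zero (s := Finset.Icc a b) fun k hk => h k (by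
    simp only [Finset.mem_Icc] at hk; omega)

theorem tsum_add_right_int (f : ℤ → ℂ) (c : ℤ) : ∑' k, f (k + c) = ∑' k, f k :=
  (Equiv.addRight c).tsum_eq f

theorem one_sub_zpow_ne_zero {q : ℂ} (hq : ‖q‖ < 1) {n : ℤ} (hn : 0 < n) : 1 - q ^ n ≠ 0 := by
  obtain ⟨m, rfl⟩ := Int.eq_ofNat_of_zero_le hn.le
  rw [zpow_natCast]
  exact one_sub_pow_ne_zero hq (by omega)

/-- The finite `q`-binomial theorem, in the normalisation with reciprocal `q`-factorials. -/
theorem tsum_qBinomial {q : ℂ} (hq0 : q ≠ 0) (hq : ‖q‖ < 1) {w : ℂ} (hw : w ≠ 0) (N : ℕ) :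
    ∑' k : ℤ, (-w) ^ k * q ^ (k * (k - 1) / 2) * invQFactorial q k * invQFactorial q (N - k)
      = (∏ j ∈ Finset.range N, (1 - w * q ^ j)) * invQFactorial q N := by
  induction N with
  | zero =>
    rw [tsum_eq_single 0 fun k hk => ?_]
    · simp [invQFactorial_zero]
    · rcases lt_or_gt_of_ne hk with h | h
      · rw [invQFactorial_of_neg q h]; ring
      · rw [invQFactorial_of_neg q (n := ((0 : ℕ) : ℤ) - k) (by push_cast; omega), mul_zero]
  | succ N ih =>
    set f : ℤ → ℂ := fun k =>
      (-w) ^ k * q ^ (k * (k - 1) / 2) * invQFactorial q k * invQFactorial q (N - k) with hf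
    set g : ℤ → ℂ := fun k => (-w) ^ k * q ^ (k * (k - 1) / 2) * q ^ ((N : ℤ) + 1 - k)
      * invQFactorial q (k - 1) * invQFactorial q (N + 1 - k) with hg
    have hfs : Summable f := summable_of_eq_zero_off_Icc 0 N fun k hk => by
      rcases hk with h | h
      · simp only [hf, invQFactorial_of_neg q h]; ring
      · simp only [hf]; rw [invQFactorial_of_neg q (n := (N : ℤ) - k) (by omega), mul_zero]
    have hgs : Summable g := summable_of_eq_zero_off_Icc 0 (N + 1) fun k hk => by
      rcases hk with h | h
      · simp only [hg]; rw [invQFactorial_of_neg q (n := k - 1) (by omega)]; ring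
      · simp only [hg]; rw [invQFactorial_of_neg q (n := (N : ℤ) + 1 - k) (by omega), mul_zero]
    have hne : (1 - q ^ ((N : ℤ) + 1)) ≠ 0 := one_sub_zpow_ne_zero hq (by omega)
    have hw' : -w ≠ 0 := neg_ne_zero.mpr hw
    have hgf : ∑' k, g k = -(w * q ^ N) * ∑' k, f k := by
      rw [← tsum_add_right_int g 1, ← tsum_mul_left]
      refine tsum_congr fun k => ?_
      have he : (k + 1) * k / 2 = k * (k - 1) / 2 + k := by
        have h1 := two_mul_ediv_mul_sub_one k
        have h2 := two_mul_ediv_mul_sub_one (k + 1)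
        have h3 : (k + 1) * (k + 1 - 1) = k * (k - 1) + 2 * k := by ring
        rw [add_sub_cancel_right] at h2 h3
        omega
      have hs : q ^ k * q ^ ((N : ℤ) - k) = q ^ N := by
        rw [← zpow_add₀ hq0, ← zpow_natCast]; congr 1; ring
      simp only [hf, hg, add_sub_cancel_right, he]
      rw [zpow_add₀ hq0, zpow_add_one₀ hw', show (N : ℤ) + 1 - (k + 1) = N - k by ring]
      linear_combination ((-w) ^ k * -w * q ^ (k * (k - 1) / 2) * invQFactorial q k
        * invQFactorial q (N - k)) * hs
    -- The q-Pascal rule: 1 − q^(N+1) = (1 − q^(N+1−k)) + q^(N+1−k)(1 − q^k), each bracket being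
    -- absorbed by a reciprocal factorial.
    have key : (1 - q ^ ((N : ℤ) + 1)) * ∑' k : ℤ, (-w) ^ k * q ^ (k * (k - 1) / 2)
        * invQFactorial q k * invQFactorial q ((N + 1 : ℕ) - k)
        = ∑' k, f k + ∑' k, g k := by
      rw [← hfs.tsum_add hgs, ← tsum_mul_left]
      refine tsum_congr fun k => ?_
      have h1 := one_sub_zpow_mul_invQFactorial hq k
      have h2 := one_sub_zpow_mul_invQFactorial hq ((N : ℤ) + 1 - k)
      rw [show (N : ℤ) + 1 - k - 1 = N - k by ring] at h2
      have h3 : q ^ ((N : ℤ) + 1) = q ^ ((N : ℤ) + 1 - k) * q ^ k := by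
        rw [← zpow_add₀ hq0]; congr 1; ring
      simp only [hf, hg, ← h1, ← h2, h3]
      push_cast
      ring
    have hc := one_sub_zpow_mul_invQFactorial hq ((N : ℤ) + 1)
    rw [add_sub_cancel_right] at hc
    rw [hgf, ih, ← hc] at key
    rw [Finset.prod_range_succ]
    apply mul_left_cancel₀ hne
    rw [key]
    push_cast
    ring

/-- `θ(z;q) = ∑_{n ∈ ℤ} (-z)^n q^{n(n-1)/2}`. -/
noncomputable def jacobiSeries (z q : ℂ) : ℂ := ∑' n : ℤ, (-z) ^ n * q ^ (n * (n - 1) / 2)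

theorem prod_one_sub_mul_inv_pow {q : ℂ} (hq0 : q ≠ 0) {z : ℂ} (hz : z ≠ 0) (n : ℕ) :
    ∏ j ∈ Finset.range n, (1 - z * (q ^ (j + 1))⁻¹)
      = (-z) ^ n * q ^ (-((n : ℤ) * (n + 1) / 2)) * qShiftedFactorial (q / z) q n := by
  induction n with
  | zero => simp [qShiftedFactorial]
  | succ n ih =>
    have he : -(((n + 1 : ℕ) : ℤ) * ((n + 1 : ℕ) + 1) / 2)
        = -((n : ℤ) * (n + 1) / 2) + -((n + 1 : ℕ) : ℤ) := by
      have h1 := two_mul_ediv_mul_add_one n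
      have h2 := two_mul_ediv_mul_add_one ((n : ℤ) + 1)
      have h3 : ((n : ℤ) + 1) * (n + 1 + 1) = n * (n + 1) + 2 * (n + 1) := by ring
      push_cast
      omega
    rw [Finset.prod_range_succ, ih, qShiftedFactorial_succ, he, zpow_add₀ hq0, zpow_neg q
      ((n + 1 : ℕ) : ℤ), zpow_natCast]
    field_simp
    ring

/-- This is the q-binomial theorem with 2n factors at w = z q^(−n), recentred by k = r + n; half of
the factors are then inverted to produce (q/z;q)_n. -/
theorem tsum_finite_tripleProduct {q : ℂ} (hq0 : q ≠ 0) (hq : ‖q‖ < 1) {z : ℂ} (hz : z ≠ 0)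
    (n : ℕ) :
    ∑' r : ℤ, (-z) ^ r * q ^ (r * (r - 1) / 2) * (invQFactorial q (n + r) * invQFactorial q (n - r))
      = qShiftedFactorial z q n * qShiftedFactorial (q / z) q n
        * invQFactorial q (2 * n : ℕ) := by
  have hqn : q ^ n ≠ 0 := pow_ne_zero _ hq0
  have hw : z * (q ^ n)⁻¹ ≠ 0 := mul_ne_zero hz (inv_ne_zero hqn)
  have h := tsum_qBinomial hq0 hq hw (2 * n)
  rw [← tsum_add_right_int _ (n : ℤ)] at h
  have hz' : -z ≠ 0 := neg_ne_zero.mpr hz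
  have hprod : ∏ j ∈ Finset.range (2 * n), (1 - z * (q ^ n)⁻¹ * q ^ j)
      = (-z) ^ n * q ^ (-((n : ℤ) * (n + 1) / 2))
        * (qShiftedFactorial z q n * qShiftedFactorial (q / z) q n) := by
    rw [two_mul, Finset.prod_range_add]
    have h1 : ∏ j ∈ Finset.range n, (1 - z * (q ^ n)⁻¹ * q ^ (n + j)) = qShiftedFactorial z q n :=
      Finset.prod_congr rfl fun j _ => by rw [pow_add]; field_simp
    have h2 : ∏ j ∈ Finset.range n, (1 - z * (q ^ n)⁻¹ * q ^ j)
        = ∏ j ∈ Finset.range n, (1 - z * (q ^ (j + 1))⁻¹) := by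
      rw [← Finset.prod_range_reflect]
      refine Finset.prod_congr rfl fun j hj => ?_
      have hj' := Finset.mem_range.mp hj
      have h3 : q ^ n = q ^ (n - 1 - j) * q ^ (j + 1) := by rw [← pow_add]; congr 1; omega
      rw [h3]
      field_simp
    rw [h1, h2, prod_one_sub_mul_inv_pow hq0 hz]
    ring
  have hC : (-z) ^ n * q ^ (-((n : ℤ) * (n + 1) / 2)) ≠ 0 :=
    mul_ne_zero (pow_ne_zero _ hz') (zpow_ne_zero _ hq0)
  apply mul_left_cancel₀ hC
  rw [← mul_assoc, ← hprod, ← h, ← tsum_mul_left]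
  refine tsum_congr fun r => ?_
  have e1 : (-(z * (q ^ n)⁻¹)) ^ (r + n) = (-z) ^ r * (-z) ^ n * q ^ (-(n * (r + n)) : ℤ) := by
    rw [← neg_mul, mul_zpow, zpow_add₀ hz', zpow_natCast, ← zpow_natCast q n, ← zpow_neg,
      ← zpow_mul, neg_mul]
  have e2 : (r + n) * (r + n - 1) / 2 + -(n * (r + n))
      = r * (r - 1) / 2 + -((n : ℤ) * (n + 1) / 2) := by
    have h1 := two_mul_ediv_mul_add_one n
    have h2 := two_mul_ediv_mul_sub_one r
    have h3 := two_mul_ediv_mul_sub_one (r + n)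
    have h4 : (r + n) * (r + n - 1) + n * (n + 1) + -(2 * (n * (r + n))) = r * (r - 1) := by ring
    omega
  have e3 : q ^ ((r + n) * (r + n - 1) / 2) * q ^ (-(n * (r + n)) : ℤ)
      = q ^ (r * (r - 1) / 2) * q ^ (-((n : ℤ) * (n + 1) / 2)) := by
    rw [← zpow_add₀ hq0, ← zpow_add₀ hq0, e2]
  rw [e1, add_comm (n : ℤ) r, show ((2 * n : ℕ) : ℤ) - (r + n) = n - r by push_cast; ring]
  linear_combination (-((-z) ^ r * (-z) ^ n * invQFactorial q (r + n) * invQFactorial q (n - r))) * e3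

theorem tendsto_natCast_add_atTop (r : ℤ) : Tendsto (fun n : ℕ => (n : ℤ) + r) atTop atTop :=
  tendsto_atTop_add_const_right _ r tendsto_natCast_atTop_atTop

/-- Let n → ∞ in the finite form; the reciprocal factorials are uniformly bounded, so dominated
convergence applies. -/
theorem jacobi_tripleProduct {q : ℂ} (hq0 : q ≠ 0) (hq : ‖q‖ < 1) {z : ℂ} (hz : z ≠ 0) :
    jacobiSeries z q = qShiftedFactorialInf q q * qShiftedFactorialInf z q
      * qShiftedFactorialInf (q / z) q := by
  obtain ⟨M, hM0, hM⟩ := exists_norm_invQFactorial_le hq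
  have hne : qShiftedFactorialInf q q ≠ 0 := by
    simpa using qShiftedFactorialInf_ne_zero hq one_ne_zero
  set c := (qShiftedFactorialInf q q)⁻¹ with hc
  have h1 : Tendsto (fun n : ℕ => ∑' r : ℤ, (-z) ^ r * q ^ (r * (r - 1) / 2)
      * (invQFactorial q (n + r) * invQFactorial q (n - r))) atTop
      (𝓝 (∑' r : ℤ, (-z) ^ r * q ^ (r * (r - 1) / 2) * (c * c))) := by
    refine tendsto_tsum_of_dominated_convergence
      (bound := fun r : ℤ => ‖(-z) ^ r * q ^ (r * (r - 1) / 2)‖ * (M * M))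
      ((summable_zpow_mul_zpow hq0 hq (-z)).norm.mul_right _) (fun r => ?_)
      (Eventually.of_forall fun n r => ?_)
    · exact (((tendsto_invQFactorial hq).comp (tendsto_natCast_add_atTop r)).mul
        ((tendsto_invQFactorial hq).comp (tendsto_natCast_add_atTop (-r)))).const_mul _
    · rw [norm_mul, norm_mul (invQFactorial q _)]
      gcongr
      · exact hM _
      · exact hM _
  have h2 : Tendsto (fun n : ℕ => qShiftedFactorial z q n * qShiftedFactorial (q / z) q n
      * invQFactorial q (2 * n : ℕ)) atTop
      (𝓝 (qShiftedFactorialInf z q * qShiftedFactorialInf (q / z) q * c)) :=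
    ((tendsto_qShiftedFactorial hq _).mul (tendsto_qShiftedFactorial hq _)).mul
      ((tendsto_invQFactorial_natCast hq).comp (tendsto_id.const_mul_atTop' two_pos))
  simp only [tsum_finite_tripleProduct hq0 hq hz] at h1
  have h3 := tendsto_nhds_unique h1 h2
  rw [tsum_mul_right] at h3
  have h4 : jacobiSeries z q * (c * c)
      = qShiftedFactorialInf z q * qShiftedFactorialInf (q / z) q * c := h3
  rw [hc] at h4
  field_simp at h4
  linear_combination h4

/-! ### q-Vandermonde, Bailey's lemma and the Rogers–Ramanujan identities -/

theorem tsum_qVandermonde_natCast {q : ℂ} (hq0 : q ≠ 0) (hq : ‖q‖ < 1) (N : ℕ) (m : ℤ) :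
    ∑' k : ℤ, q ^ (k * (k + m)) * (invQFactorial q (N - k) * invQFactorial q k
      * invQFactorial q (k + m)) = invQFactorial q N * invQFactorial q (N + m) := by
  induction N generalizing m with
  | zero =>
    rw [tsum_eq_single 0 fun k hk => ?_]
    · simp [invQFactorial_zero]
    · rcases lt_or_gt_of_ne hk with h | h
      · rw [invQFactorial_of_neg q h]; ring
      · rw [invQFactorial_of_neg q (n := ((0 : ℕ) : ℤ) - k) (by push_cast; omega)]; ring
  | succ N ih =>
    set f : ℤ → ℤ → ℂ := fun m k => q ^ (k * (k + m)) * (invQFactorial q (N - k)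
      * invQFactorial q k * invQFactorial q (k + m)) with hf
    set g : ℤ → ℂ := fun k => q ^ ((N : ℤ) + 1 - k) * (q ^ (k * (k + m))
      * (invQFactorial q (N + 1 - k) * invQFactorial q (k - 1) * invQFactorial q (k + m))) with hg
    have hfs : Summable (f m) := summable_of_eq_zero_off_Icc 0 N fun k hk => by
      rcases hk with h | h
      · simp only [hf, invQFactorial_of_neg q h]; ring
      · simp only [hf]; rw [invQFactorial_of_neg q (n := (N : ℤ) - k) (by omega)]; ring
    have hgs : Summable g := summable_of_eq_zero_off_Icc 0 (N + 1) fun k hk => by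
      rcases hk with h | h
      · simp only [hg]; rw [invQFactorial_of_neg q (n := k - 1) (by omega)]; ring
      · simp only [hg]; rw [invQFactorial_of_neg q (n := (N : ℤ) + 1 - k) (by omega)]; ring
    have hne : (1 - q ^ ((N : ℤ) + 1)) ≠ 0 := one_sub_zpow_ne_zero hq (by omega)
    -- Shifting k by one turns the second half of the Pascal splitting into the same sum with m + 1,
    -- which is why the induction is over all m.
    have hgf : ∑' k, g k = q ^ ((N : ℤ) + 1 + m) * ∑' k, f (m + 1) k := by
      rw [← tsum_add_right_int g 1, ← tsum_mul_left]
      refine tsum_congr fun k => ?_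
      have hs : q ^ ((N : ℤ) - k) * q ^ ((k + 1) * (k + 1 + m))
          = q ^ ((N : ℤ) + 1 + m) * q ^ (k * (k + (m + 1))) := by
        rw [← zpow_add₀ hq0, ← zpow_add₀ hq0]; congr 1; ring
      simp only [hf, hg, add_sub_cancel_right]
      rw [show (N : ℤ) + 1 - (k + 1) = N - k by ring, show k + 1 + m = k + (m + 1) by ring] at *
      linear_combination (invQFactorial q (N - k) * invQFactorial q k
        * invQFactorial q (k + (m + 1))) * hs
    have key : (1 - q ^ ((N : ℤ) + 1)) * ∑' k : ℤ, q ^ (k * (k + m))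
        * (invQFactorial q ((N + 1 : ℕ) - k) * invQFactorial q k * invQFactorial q (k + m))
        = ∑' k, f m k + ∑' k, g k := by
      rw [← hfs.tsum_add hgs, ← tsum_mul_left]
      refine tsum_congr fun k => ?_
      have h1 := one_sub_zpow_mul_invQFactorial hq k
      have h2 := one_sub_zpow_mul_invQFactorial hq ((N : ℤ) + 1 - k)
      rw [show (N : ℤ) + 1 - k - 1 = N - k by ring] at h2
      have h3 : q ^ ((N : ℤ) + 1) = q ^ ((N : ℤ) + 1 - k) * q ^ k := by
        rw [← zpow_add₀ hq0]; congr 1; ring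
      simp only [hf, hg, ← h1, ← h2, h3]
      push_cast
      ring
    have hc := one_sub_zpow_mul_invQFactorial hq ((N : ℤ) + 1)
    have hc' := one_sub_zpow_mul_invQFactorial hq ((N : ℤ) + 1 + m)
    rw [add_sub_cancel_right] at hc
    rw [show (N : ℤ) + 1 + m - 1 = N + m by ring] at hc'
    rw [hgf, ih, ih, ← hc, ← hc', show (N : ℤ) + (m + 1) = N + 1 + m by ring] at key
    apply mul_left_cancel₀ hne
    rw [key]
    push_cast
    ring

theorem tsum_qVandermonde {q : ℂ} (hq0 : q ≠ 0) (hq : ‖q‖ < 1) (N m : ℤ) :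
    ∑' k : ℤ, q ^ (k * (k + m)) * (invQFactorial q (N - k) * invQFactorial q k
      * invQFactorial q (k + m)) = invQFactorial q N * invQFactorial q (N + m) := by
  rcases lt_or_ge N 0 with h | h
  · rw [invQFactorial_of_neg q h, zero_mul, ← tsum_zero (α := ℂ) (β := ℤ)]
    refine tsum_congr fun k => ?_
    rcases lt_or_ge k 0 with hk | hk
    · rw [invQFactorial_of_neg q hk]; ring
    · rw [invQFactorial_of_neg q (n := N - k) (by omega)]; ring
  · obtain ⟨n, rfl⟩ := Int.eq_ofNat_of_zero_le h
    exact tsum_qVandermonde_natCast hq0 hq n m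

/-- The limiting Bailey lemma for bilateral pairs relative to `q ^ e`, `e ∈ {0, 1}`. -/
theorem tsum_bailey {q : ℂ} (hq0 : q ≠ 0) (hq : ‖q‖ < 1) {e : ℤ} (he0 : 0 ≤ e) (he1 : e ≤ 1)
    (α : ℤ → ℂ) (n : ℤ) :
    ∑' s : ℤ, q ^ (s * (s + e)) * invQFactorial q (n - s)
        * ∑' r : ℤ, α r * (invQFactorial q (s - r) * invQFactorial q (s + r + e))
      = ∑' r : ℤ, q ^ (r * (r + e)) * α r
        * (invQFactorial q (n - r) * invQFactorial q (n + r + e)) := by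
  set F : ℤ → ℤ → ℂ := fun s r => q ^ (s * (s + e)) * invQFactorial q (n - s)
    * (α r * (invQFactorial q (s - r) * invQFactorial q (s + r + e))) with hF
  have hs : Summable (Function.uncurry F) := by
    refine summable_of_ne_finset_zero
      (s := Finset.Icc (-(n + 2)) (n + 2) ×ˢ Finset.Icc (-(n + 2)) (n + 2)) fun p hp => ?_
    obtain ⟨s, r⟩ := p
    simp only [Finset.mem_product, Finset.mem_Icc] at hp
    simp only [Function.uncurry, hF]
    by_cases h1 : n - s < 0
    · rw [invQFactorial_of_neg q h1]; ring
    by_cases h2 : s - r < 0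
    · rw [invQFactorial_of_neg q h2]; ring
    by_cases h3 : s + r + e < 0
    · rw [invQFactorial_of_neg q h3]; ring
    omega
  simp_rw [← tsum_mul_left]
  change ∑' s, ∑' r, F s r = _
  rw [← hs.tsum_comm]
  refine tsum_congr fun r => ?_
  -- After interchanging the sums and putting s = k + r, the inner sum is exactly q-Vandermonde.
  have hV := tsum_qVandermonde hq0 hq (n - r) (2 * r + e)
  rw [show n - r + (2 * r + e) = n + r + e by ring] at hV
  rw [← hV, ← tsum_add_right_int (fun s => F s r) r, ← tsum_mul_left]
  refine tsum_congr fun k => ?_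
  have h1 : q ^ ((k + r) * (k + r + e)) = q ^ (r * (r + e)) * q ^ (k * (k + (2 * r + e))) := by
    rw [← zpow_add₀ hq0]; congr 1; ring
  simp only [hF, h1]
  rw [show n - (k + r) = n - r - k by ring, show k + r - r = k by ring,
    show k + r + r + e = k + (2 * r + e) by ring]
  ring

/-- The unit Bailey pair, from which everything is iterated. For n > 0 the sum is a q-binomial sum
whose product contains a zero factor. -/
theorem tsum_bailey_initial {q : ℂ} (hq0 : q ≠ 0) (hq : ‖q‖ < 1) {e : ℤ} (he : e = 0 ∨ e = 1)
    (n : ℤ) :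
    ∑' r : ℤ, (-1) ^ r * q ^ (r * (r - 1) / 2)
      * (invQFactorial q (n - r) * invQFactorial q (n + r + e)) = if n = 0 then 1 else 0 := by
  rcases lt_trichotomy n 0 with h | rfl | h
  · rw [if_neg h.ne, ← tsum_zero (α := ℂ) (β := ℤ)]
    refine tsum_congr fun r => ?_
    by_cases h2 : n - r < 0
    · rw [invQFactorial_of_neg q h2]; ring
    · rw [invQFactorial_of_neg q (n := n + r + e) (by omega)]; ring
  · rw [if_pos rfl]
    rcases he with rfl | rfl
    · rw [tsum_eq_single 0 fun k hk => ?_]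
      · simp [invQFactorial_zero]
      · rcases lt_or_gt_of_ne hk with h | h
        · rw [invQFactorial_of_neg q (n := 0 + k + 0) (by omega)]; ring
        · rw [invQFactorial_of_neg q (n := 0 - k) (by omega)]; ring
    · rw [tsum_eq_sum (s := {0, -1}) fun k hk => ?_]
      · rw [Finset.sum_pair (by norm_num)]
        have h1 := one_sub_zpow_mul_invQFactorial hq 1
        norm_num [invQFactorial_zero] at h1 ⊢
        linear_combination h1
      · simp only [Finset.mem_insert, Finset.mem_singleton, not_or] at hk
        rcases lt_or_gt_of_ne hk.1 with h | h
        · rw [invQFactorial_of_neg q (n := 0 + k + 1) (by omega)]; ring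
        · rw [invQFactorial_of_neg q (n := 0 - k) (by omega)]; ring
  · rw [if_neg h.ne']
    obtain ⟨N, hN⟩ : ∃ N : ℕ, (N : ℤ) = 2 * n + e := ⟨(2 * n + e).toNat, by omega⟩
    have hB := tsum_qBinomial hq0 hq (zpow_ne_zero (1 - n) hq0) N
    have hz : ∏ j ∈ Finset.range N, (1 - q ^ (1 - n) * q ^ j) = 0 := by
      -- The factor with j = n − 1 is 1 − q^(1−n) q^(n−1) = 0.
      refine Finset.prod_eq_zero (i := (n - 1).toNat) (Finset.mem_range.mpr (by omega)) ?_
      rw [← zpow_natCast, Int.toNat_of_nonneg (by omega), ← zpow_add₀ hq0]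
      simp
    rw [hz, zero_mul, ← tsum_add_right_int _ n, ← (Equiv.neg ℤ).tsum_eq] at hB
    have h1 : (-1 : ℂ) ^ n * q ^ (n * (n - 1) / 2 + n * (1 - n)) ≠ 0 :=
      mul_ne_zero (zpow_ne_zero _ (by norm_num)) (zpow_ne_zero _ hq0)
    apply mul_left_cancel₀ h1
    rw [mul_zero, ← hB, ← tsum_mul_left]
    refine tsum_congr fun r => ?_
    have e1 : (-q ^ (1 - n)) ^ (-r + n) = (-1) ^ n * (-1) ^ r * q ^ ((1 - n) * (-r + n)) := by
      rw [neg_eq_neg_one_mul, mul_zpow, zpow_add₀ (by norm_num), ← zpow_mul, zpow_neg,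
        ← inv_zpow, mul_comm ((-1 : ℂ) ^ n)]
      norm_num
    have e2 : n * (n - 1) / 2 + n * (1 - n) + r * (r - 1) / 2
        = (1 - n) * (-r + n) + (-r + n) * (-r + n - 1) / 2 := by
      have h1 := two_mul_ediv_mul_sub_one n
      have h2 := two_mul_ediv_mul_sub_one r
      have h3 := two_mul_ediv_mul_sub_one (-r + n)
      linarith
    have e3 := congrArg (q ^ ·) e2
    beta_reduce at e3
    rw [zpow_add₀ hq0 _ (r * (r - 1) / 2), zpow_add₀ hq0 ((1 - n) * (-r + n))] at e3
    simp only [Equiv.neg_apply, e1]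
    rw [show (N : ℤ) - (-r + n) = n + r + e by omega, show -r + n = n - r by ring] at *
    linear_combination ((-1) ^ n * (-1) ^ r * invQFactorial q (n - r)
      * invQFactorial q (n + r + e)) * e3

theorem jacobiSeries_pow {q : ℂ} (hq0 : q ≠ 0) (a b : ℕ) :
    jacobiSeries (q ^ a) (q ^ b)
      = ∑' n : ℤ, (-1) ^ n * q ^ (a * n + b * (n * (n - 1) / 2)) := by
  refine tsum_congr fun n => ?_
  rw [neg_eq_neg_one_mul, mul_zpow, zpow_add₀ hq0, zpow_mul, zpow_mul, zpow_natCast, zpow_natCast]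
  ring

theorem tsum_bailey_iterate {q : ℂ} (hq0 : q ≠ 0) (hq : ‖q‖ < 1) {e : ℤ} (he : e = 0 ∨ e = 1)
    (n : ℤ) :
    ∑' r : ℤ, q ^ (r * (r + e)) * ((-1) ^ r * q ^ (r * (r - 1) / 2))
      * (invQFactorial q (n - r) * invQFactorial q (n + r + e)) = invQFactorial q n := by
  rw [← tsum_bailey hq0 hq (by omega) (by omega)]
  simp_rw [tsum_bailey_initial hq0 hq he]
  rw [tsum_eq_single 0 fun s hs => by rw [if_neg hs, mul_zero]]
  simp

/-- Two Bailey steps add 2r(r+e) to the initial exponent r(r−1)/2, giving (2+2e)r + 5r(r−1)/2. The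
identity is the limit n → ∞ of the second step; e = 0 yields G and e = 1 yields H. -/
theorem tsum_int_rogersRamanujan {q : ℂ} (hq0 : q ≠ 0) (hq : ‖q‖ < 1) {e : ℕ}
    (he : e = 0 ∨ e = 1) :
    (∑' s : ℤ, q ^ (s * (s + e)) * invQFactorial q s) * qShiftedFactorialInf q q
      = jacobiSeries (q ^ (2 + 2 * e)) (q ^ 5) := by
  obtain ⟨M, hM0, hM⟩ := exists_norm_invQFactorial_le hq
  have hne : qShiftedFactorialInf q q ≠ 0 := by
    simpa using qShiftedFactorialInf_ne_zero hq one_ne_zero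
  have he' : (e : ℤ) = 0 ∨ (e : ℤ) = 1 := by omega
  set c := (qShiftedFactorialInf q q)⁻¹ with hc
  have hq2 : ∀ m : ℕ, m ≠ 0 → ‖q ^ m‖ < 1 := fun m hm => by
    rw [norm_pow]; exact pow_lt_one₀ (norm_nonneg q) hq hm
  have hlim : ∀ r : ℤ, Tendsto (fun n : ℕ => invQFactorial q (n + r)) atTop (𝓝 c) := fun r =>
    (tendsto_invQFactorial hq).comp (tendsto_natCast_add_atTop r)
  have hs1 : Summable fun s : ℤ => q ^ (s * (s + e)) := by
    refine (summable_zpow_mul_zpow (pow_ne_zero 2 hq0) (hq2 2 two_ne_zero)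
      (q ^ (1 + e))).congr fun s => ?_
    rw [← zpow_natCast, ← zpow_natCast, ← zpow_mul, ← zpow_mul, ← zpow_add₀ hq0]
    congr 1
    push_cast
    rw [two_mul_ediv_mul_sub_one]; ring
  have hexp : ∀ r : ℤ, q ^ (r * (r + e)) * (q ^ (r * (r + e)) * ((-1) ^ r * q ^ (r * (r - 1) / 2)))
      = (-q ^ (2 + 2 * e)) ^ r * (q ^ 5) ^ (r * (r - 1) / 2) := fun r => by
    rw [neg_eq_neg_one_mul (q ^ _), mul_zpow, ← zpow_natCast, ← zpow_natCast, ← zpow_mul,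
      ← zpow_mul]
    have h1 : q ^ (r * (r + e)) * q ^ (r * (r + e)) * q ^ (r * (r - 1) / 2)
        = q ^ (((2 + 2 * e : ℕ) : ℤ) * r) * q ^ (((5 : ℕ) : ℤ) * (r * (r - 1) / 2)) := by
      rw [← zpow_add₀ hq0, ← zpow_add₀ hq0, ← zpow_add₀ hq0]
      congr 1
      have h2 := two_mul_ediv_mul_sub_one r
      push_cast
      linarith
    linear_combination (-1) ^ r * h1
  have hs2 : Summable fun r : ℤ =>
      q ^ (r * (r + e)) * (q ^ (r * (r + e)) * ((-1) ^ r * q ^ (r * (r - 1) / 2))) := by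
    simp_rw [hexp]
    exact summable_zpow_mul_zpow (pow_ne_zero 5 hq0) (hq2 5 (by norm_num)) _
  have h1 : Tendsto (fun n : ℕ => ∑' s : ℤ, q ^ (s * (s + e)) * invQFactorial q (n - s)
      * invQFactorial q s) atTop (𝓝 (∑' s : ℤ, q ^ (s * (s + e)) * c * invQFactorial q s)) := by
    refine tendsto_tsum_of_dominated_convergence
      (bound := fun s : ℤ => ‖q ^ (s * (s + e))‖ * M * M)
      ((hs1.norm.mul_right M).mul_right M) (fun s => ?_) (Eventually.of_forall fun n s => ?_)
    · exact ((hlim (-s)).const_mul _).mul_const _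
    · rw [norm_mul, norm_mul]
      gcongr
      · exact hM _
      · exact hM _
  have h2 : Tendsto (fun n : ℕ => ∑' r : ℤ,
      q ^ (r * (r + e)) * (q ^ (r * (r + e)) * ((-1) ^ r * q ^ (r * (r - 1) / 2)))
        * (invQFactorial q (n - r) * invQFactorial q (n + r + e))) atTop
      (𝓝 (∑' r : ℤ, q ^ (r * (r + e)) * (q ^ (r * (r + e)) * ((-1) ^ r * q ^ (r * (r - 1) / 2)))
        * (c * c))) := by
    refine tendsto_tsum_of_dominated_convergence
      (bound := fun r : ℤ =>
        ‖q ^ (r * (r + e)) * (q ^ (r * (r + e)) * ((-1) ^ r * q ^ (r * (r - 1) / 2)))‖ * (M * M))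
      (hs2.norm.mul_right _) (fun r => ?_) (Eventually.of_forall fun n r => ?_)
    · have h := hlim (r + e)
      simp only [← add_assoc] at h
      exact ((hlim (-r)).mul h).const_mul _
    · rw [norm_mul, norm_mul (invQFactorial q _)]
      gcongr
      · exact hM _
      · exact hM _
  -- The second Bailey step, applied to the pair whose β-sequence is 1/(q;q)_n.
  have hb : ∀ n : ℕ, _ := fun n => tsum_bailey hq0 hq (show (0 : ℤ) ≤ e by omega)
    (show (e : ℤ) ≤ 1 by omega) (fun r => q ^ (r * (r + e)) * ((-1) ^ r * q ^ (r * (r - 1) / 2))) n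
  simp_rw [tsum_bailey_iterate hq0 hq he'] at hb
  simp only [← hb] at h2
  have h3 := tendsto_nhds_unique h1 h2
  simp_rw [hexp, mul_right_comm _ c] at h3
  rw [tsum_mul_right, tsum_mul_right] at h3
  have h4 : (∑' s : ℤ, q ^ (s * (s + e)) * invQFactorial q s) * c
      = jacobiSeries (q ^ (2 + 2 * e)) (q ^ 5) * (c * c) := h3
  rw [hc] at h4
  field_simp at h4
  exact h4

theorem tsum_int_mul_invQFactorial (q : ℂ) (f : ℤ → ℂ) :
    ∑' s : ℤ, f s * invQFactorial q s = ∑' n : ℕ, f n / qShiftedFactorial q q n := by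
  rw [← (Nat.cast_injective (R := ℤ)).tsum_eq]
  · simp only [invQFactorial_natCast, div_eq_mul_inv]
  · intro s hs
    by_contra h
    refine hs ?_
    have : s < 0 := by
      by_contra h'
      exact h ⟨s.toNat, by omega⟩
    show f s * invQFactorial q s = 0
    rw [invQFactorial_of_neg q this, mul_zero]

theorem rogersG_mul_qShiftedFactorialInf {q : ℂ} (hq0 : q ≠ 0) (hq : ‖q‖ < 1) :
    rogersG q * qShiftedFactorialInf q q = jacobiSeries (q ^ 2) (q ^ 5) := by
  have h := tsum_int_rogersRamanujan hq0 hq (e := 0) (Or.inl rfl)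
  rw [tsum_int_mul_invQFactorial] at h
  rw [← h, rogersG]
  congr 2
  ext n
  congr 1
  rw [← zpow_natCast]; congr 1; push_cast; ring

theorem rogersH_mul_qShiftedFactorialInf {q : ℂ} (hq0 : q ≠ 0) (hq : ‖q‖ < 1) :
    rogersH q * qShiftedFactorialInf q q = jacobiSeries (q ^ 4) (q ^ 5) := by
  have h := tsum_int_rogersRamanujan hq0 hq (e := 1) (Or.inr rfl)
  rw [tsum_int_mul_invQFactorial] at h
  rw [← h, rogersH]
  congr 2

/-! ### Pentagonal numbers, the quintuple product and the 5-dissection of Euler's function -/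

theorem norm_pow_lt_one {q : ℂ} (hq : ‖q‖ < 1) {m : ℕ} (hm : m ≠ 0) : ‖q ^ m‖ < 1 := by
  rw [norm_pow]; exact pow_lt_one₀ (norm_nonneg q) hq hm

theorem qShiftedFactorialInf_eq_prod {q : ℂ} (hq : ‖q‖ < 1) (a : ℂ) {m : ℕ} (hm : m ≠ 0) :
    qShiftedFactorialInf a q = ∏ i ∈ Finset.range m, qShiftedFactorialInf (a * q ^ i) (q ^ m) := by
  have hfin : ∀ n : ℕ, qShiftedFactorial a q (m * n)
      = ∏ i ∈ Finset.range m, qShiftedFactorial (a * q ^ i) (q ^ m) n := fun n => by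
    induction n with
    | zero => simp [qShiftedFactorial]
    | succ n ih =>
      simp_rw [qShiftedFactorial_succ]
      rw [Finset.prod_mul_distrib, ← ih, mul_add, mul_one, qShiftedFactorial,
        Finset.prod_range_add]
      refine congrArg _ (Finset.prod_congr rfl fun i _ => ?_)
      rw [pow_add, ← pow_mul]; ring
  refine tendsto_nhds_unique ((tendsto_qShiftedFactorial hq a).comp
    (tendsto_id.const_mul_atTop' (Nat.pos_of_ne_zero hm))) ?_
  refine (tendsto_finsetProd (Finset.range m) fun i _ =>
    tendsto_qShiftedFactorial (norm_pow_lt_one hq hm) (a * q ^ i)).congr fun n => ?_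
  exact (hfin n).symm

theorem qShiftedFactorialInf_mul_neg {q : ℂ} (hq : ‖q‖ < 1) (a : ℂ) :
    qShiftedFactorialInf a q * qShiftedFactorialInf (-a) q
      = qShiftedFactorialInf (a ^ 2) (q ^ 2) := by
  refine tendsto_nhds_unique ((tendsto_qShiftedFactorial hq a).mul
    (tendsto_qShiftedFactorial hq (-a))) ?_
  refine (tendsto_qShiftedFactorial (norm_pow_lt_one hq two_ne_zero) (a ^ 2)).congr fun n => ?_
  rw [qShiftedFactorial, qShiftedFactorial, qShiftedFactorial, ← Finset.prod_mul_distrib]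
  refine Finset.prod_congr rfl fun i _ => ?_
  ring

theorem eulerE_eq_jacobiSeries {q : ℂ} (hq0 : q ≠ 0) : eulerE q = jacobiSeries q (q ^ 3) := by
  refine tsum_congr fun n => ?_
  have h : n * (n + 1) / 2 = n + n * (n - 1) / 2 := by
    have h1 := two_mul_ediv_mul_sub_one n
    have h2 := two_mul_ediv_mul_add_one n
    have h3 : n * (n + 1) = 2 * n + n * (n - 1) := by ring
    omega
  rw [h, zpow_add₀ (neg_ne_zero.mpr hq0), mul_assoc, ← mul_zpow]
  ring_nf

/-- Euler's pentagonal number theorem. -/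
theorem eulerE_eq_qShiftedFactorialInf {q : ℂ} (hq0 : q ≠ 0) (hq : ‖q‖ < 1) :
    eulerE q = qShiftedFactorialInf q q := by
  rw [eulerE_eq_jacobiSeries hq0, jacobi_tripleProduct (pow_ne_zero 3 hq0)
    (norm_pow_lt_one hq three_ne_zero) hq0, qShiftedFactorialInf_eq_prod hq q three_ne_zero]
  simp only [Finset.prod_range_succ, Finset.prod_range_zero, one_mul, pow_zero, mul_one, pow_one]
  rw [show q ^ 3 / q = q * q by field_simp, show q * q ^ 2 = q ^ 3 by ring]
  ring

theorem eulerE_ne_zero {q : ℂ} (hq0 : q ≠ 0) (hq : ‖q‖ < 1) : eulerE q ≠ 0 := by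
  rw [eulerE_eq_qShiftedFactorialInf hq0 hq]
  simpa using qShiftedFactorialInf_ne_zero hq one_ne_zero

theorem tsum_int_eq_sum_residues {f : ℤ → ℂ} (hf : Summable f) (m : ℕ) [NeZero m] :
    ∑' k, f k = ∑ i ∈ Finset.range m, ∑' j : ℤ, f (m * j + i) := by
  have hs : Summable fun p : Fin m × ℤ => f (m * p.2 + (p.1 : ℕ)) := by
    have := ((Int.divModEquiv m).symm.summable_iff (f := f)).mpr hf
    have h2 := (Equiv.prodComm (Fin m) ℤ).summable_iff.mpr this
    refine h2.congr fun p => ?_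
    simp [Int.divModEquiv, mul_comm]
  have h1 : ∑' k, f k = ∑' p : Fin m × ℤ, f (m * p.2 + (p.1 : ℕ)) := by
    rw [← (Int.divModEquiv m).symm.tsum_eq, ← (Equiv.prodComm (Fin m) ℤ).tsum_eq]
    refine tsum_congr fun p => ?_
    simp [Int.divModEquiv, mul_comm]
  rw [h1, hs.tsum_prod, tsum_fintype, Finset.sum_range]

theorem jacobiSeries_symm {q : ℂ} (hq0 : q ≠ 0) {z : ℂ} (hz : z ≠ 0) :
    jacobiSeries (q / z) q = jacobiSeries z q := by
  rw [jacobiSeries, ← (Equiv.neg ℤ).tsum_eq]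
  refine tsum_congr fun n => ?_
  have h : -n * (-n - 1) / 2 = n * (n - 1) / 2 + n := by
    have h1 := two_mul_ediv_mul_sub_one n
    have h2 := two_mul_ediv_mul_sub_one (-n)
    have h3 : -n * (-n - 1) = n * (n - 1) + 2 * n := by ring
    omega
  simp only [Equiv.neg_apply]
  rw [h, zpow_add₀ hq0, ← neg_div, show -q / z = q / -z by rw [div_neg, neg_div], div_zpow,
    zpow_neg, zpow_neg]
  have h4 := zpow_ne_zero n hq0
  have h5 := zpow_ne_zero n (neg_ne_zero.mpr hz)
  field_simp

theorem jacobiSeries_mul_left {q : ℂ} (hq0 : q ≠ 0) {z : ℂ} (hz : z ≠ 0) :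
    z * jacobiSeries (z * q) q = -jacobiSeries z q := by
  rw [jacobiSeries, jacobiSeries, ← tsum_mul_left, ← tsum_neg,
    ← tsum_add_right_int (fun n : ℤ => -((-z) ^ n * q ^ (n * (n - 1) / 2))) 1]
  refine tsum_congr fun n => ?_
  have h : (n + 1) * (n + 1 - 1) / 2 = n * (n - 1) / 2 + n := by
    have h1 := two_mul_ediv_mul_sub_one n
    have h2 := two_mul_ediv_mul_sub_one (n + 1)
    have h3 : (n + 1) * (n + 1 - 1) = n * (n - 1) + 2 * n := by ring
    omega
  rw [h, zpow_add₀ hq0, zpow_add_one₀ (neg_ne_zero.mpr hz), ← neg_mul, mul_zpow]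
  ring

/-- The quintuple product identity. -/
theorem jacobiSeries_quintuple {p : ℂ} (hp0 : p ≠ 0) (hp : ‖p‖ < 1) {z : ℂ} (hz : z ≠ 0) :
    jacobiSeries z p * jacobiSeries (z ^ 2 * p) (p ^ 2)
      = eulerE (p ^ 2) * (jacobiSeries (-(z ^ 3 * p)) (p ^ 3)
        - z * jacobiSeries (-(z ^ 3 * p ^ 2)) (p ^ 3)) := by
  have hp2 := norm_pow_lt_one hp two_ne_zero
  have hp20 := pow_ne_zero 2 hp0
  have hz' := neg_ne_zero.mpr hz
  have hs1 := summable_zpow_mul_zpow hp0 hp (-z)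
  have hs2 := summable_zpow_mul_zpow hp20 hp2 (-(z ^ 2 * p))
  set I : ℤ → ℂ := fun k => ∑' n : ℤ, (-1) ^ n * p ^ (3 * n ^ 2 + n - 2 * k * n) with hI
  -- The product is collected by powers of z: with m and n the two summation indices, k = m + 2n is
  -- the total degree, and `I k` is the remaining coefficient, which depends essentially on k modulo
  -- 3.
  set φ : ℤ × ℤ ≃ ℤ × ℤ :=
    { toFun := fun x => (x.1 - 2 * x.2, x.2)
      invFun := fun x => (x.1 + 2 * x.2, x.2)
      left_inv := fun x => by simp
      right_inv := fun x => by simp } with hφ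
  have hs := φ.summable_iff.mpr (hs1.norm.mul_norm hs2.norm).of_norm
  have hterm : ∀ k n : ℤ, (-z) ^ (k - 2 * n) * p ^ ((k - 2 * n) * (k - 2 * n - 1) / 2)
      * ((-(z ^ 2 * p)) ^ n * (p ^ 2) ^ (n * (n - 1) / 2))
      = (-z) ^ k * p ^ (k * (k - 1) / 2) * ((-1) ^ n * p ^ (3 * n ^ 2 + n - 2 * k * n)) := by
    intro k n
    have e1 : (-z) ^ k = (-z) ^ (k - 2 * n) * (z ^ 2) ^ n := by
      rw [← neg_sq z, ← zpow_natCast (-z), ← zpow_mul, ← zpow_add₀ hz']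
      congr 1; push_cast; ring
    have e2 : (k - 2 * n) * (k - 2 * n - 1) / 2 + n + 2 * (n * (n - 1) / 2)
        = k * (k - 1) / 2 + (3 * n ^ 2 + n - 2 * k * n) := by
      have h1 := two_mul_ediv_mul_sub_one n
      have h2 := two_mul_ediv_mul_sub_one k
      have h3 := two_mul_ediv_mul_sub_one (k - 2 * n)
      linarith
    have e3 : p ^ ((k - 2 * n) * (k - 2 * n - 1) / 2) * p ^ n * (p ^ 2) ^ (n * (n - 1) / 2)
        = p ^ (k * (k - 1) / 2) * p ^ (3 * n ^ 2 + n - 2 * k * n) := by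
      rw [← zpow_add₀ hp0, ← zpow_add₀ hp0, ← e2, zpow_add₀ hp0 _ (2 * _), zpow_mul]
      norm_cast
    rw [neg_eq_neg_one_mul (z ^ 2 * p), mul_zpow, mul_zpow, e1]
    linear_combination ((-z) ^ (k - 2 * n) * (-1) ^ n * (z ^ 2) ^ n) * e3
  have hprod : jacobiSeries z p * jacobiSeries (z ^ 2 * p) (p ^ 2)
      = ∑' k : ℤ, (-z) ^ k * p ^ (k * (k - 1) / 2) * I k := by
    rw [jacobiSeries, jacobiSeries, tsum_mul_tsum_of_summable_norm hs1.norm hs2.norm,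
      ← φ.tsum_eq]
    refine hs.tsum_prod.trans (tsum_congr fun k => ?_)
    rw [hI, ← tsum_mul_left]
    exact tsum_congr fun n => hterm k n
  have hsk : Summable fun k : ℤ => (-z) ^ k * p ^ (k * (k - 1) / 2) * I k := by
    refine hs.prod.congr fun k => ?_
    rw [hI, ← tsum_mul_left]
    exact tsum_congr fun n => hterm k n
  have hE : eulerE (p ^ 2) = ∑' n : ℤ, (-1) ^ n * p ^ (3 * n ^ 2 - n) := by
    rw [eulerE_eq_jacobiSeries hp20, ← pow_mul, jacobiSeries_pow hp0]
    refine tsum_congr fun n => ?_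
    congr 2
    have h1 := two_mul_ediv_mul_sub_one n
    push_cast
    linarith
  have hm1 : (-1 : ℂ) ≠ 0 := by norm_num
  have hI0 : ∀ j, I (3 * j) = (-1) ^ j * p ^ (-3 * j ^ 2 + j) * eulerE (p ^ 2) := fun j => by
    rw [hE, ← tsum_mul_left]
    refine ((Equiv.subLeft j).tsum_eq fun n =>
      (-1) ^ n * p ^ (3 * n ^ 2 + n - 2 * (3 * j) * n)).symm.trans (tsum_congr fun n => ?_)
    rw [Equiv.subLeft_apply, zpow_sub₀ hm1, show 3 * (j - n) ^ 2 + (j - n) - 2 * (3 * j) * (j - n)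
      = (-3 * j ^ 2 + j) + (3 * n ^ 2 - n) by ring, zpow_add₀ hp0, div_eq_mul_inv, ← inv_zpow]
    norm_num
    ring
  have hI1 : ∀ j, I (3 * j + 1) = (-1) ^ j * p ^ (-3 * j ^ 2 - j) * eulerE (p ^ 2) := fun j => by
    rw [hE, ← tsum_mul_left]
    refine (tsum_add_right_int (fun n =>
      (-1) ^ n * p ^ (3 * n ^ 2 + n - 2 * (3 * j + 1) * n)) j).symm.trans (tsum_congr fun n => ?_)
    rw [zpow_add₀ hm1, show 3 * (n + j) ^ 2 + (n + j) - 2 * (3 * j + 1) * (n + j)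
      = (-3 * j ^ 2 - j) + (3 * n ^ 2 - n) by ring, zpow_add₀ hp0]
    ring
  -- The reflection n ↦ 2j+1−n preserves the exponent and reverses the sign.
  have hI2 : ∀ j, I (3 * j + 2) = 0 := fun j => by
    have h : I (3 * j + 2) = -I (3 * j + 2) := by
      conv_lhs => rw [hI]
      rw [hI, ← tsum_neg, ← (Equiv.subLeft (2 * j + 1)).tsum_eq]
      refine tsum_congr fun n => ?_
      rw [Equiv.subLeft_apply, zpow_sub₀ hm1, zpow_add₀ hm1, zpow_mul, div_eq_mul_inv, ← inv_zpow,
        show 3 * (2 * j + 1 - n) ^ 2 + (2 * j + 1 - n) - 2 * (3 * j + 2) * (2 * j + 1 - n)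
          = 3 * n ^ 2 + n - 2 * (3 * j + 2) * n by ring]
      norm_num
    exact self_eq_neg.mp h
  rw [hprod, tsum_int_eq_sum_residues hsk 3]
  simp only [Finset.sum_range_succ, Finset.sum_range_zero, zero_add, Nat.cast_zero, add_zero,
    Nat.cast_one, Nat.cast_ofNat, hI0, hI1, hI2, mul_zero, tsum_zero]
  rw [mul_sub, jacobiSeries, jacobiSeries, ← tsum_mul_left, ← tsum_mul_left, ← tsum_mul_left,
    sub_eq_add_neg, ← tsum_neg]
  have hsgn : ∀ j : ℤ, (-1 : ℂ) ^ (3 * j) * (-1) ^ j = 1 := fun j => by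
    rw [← zpow_add₀ hm1, show 3 * j + j = 2 * (2 * j) by ring, zpow_mul]; norm_num
  have hpow3 : ∀ j : ℤ, (z ^ 3) ^ j = z ^ (3 * j) := fun j => by rw [zpow_mul]; norm_cast
  congr 1 <;> refine tsum_congr fun j => ?_
  · have e : 3 * j * (3 * j - 1) / 2 + (-3 * j ^ 2 + j) = j + 3 * (j * (j - 1) / 2) := by
      have h1 := two_mul_ediv_mul_sub_one j
      have h2 := two_mul_ediv_mul_sub_one (3 * j)
      linarith
    have e2 : p ^ (3 * j * (3 * j - 1) / 2) * p ^ (-3 * j ^ 2 + j)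
        = p ^ j * (p ^ 3) ^ (j * (j - 1) / 2) := by
      rw [← zpow_add₀ hp0, e, zpow_add₀ hp0, zpow_mul]; norm_cast
    rw [neg_neg, mul_zpow, neg_eq_neg_one_mul z, mul_zpow (-1), hpow3]
    linear_combination ((-1) ^ (3 * j) * (-1) ^ j * z ^ (3 * j) * eulerE (p ^ 2)) * e2
      + (z ^ (3 * j) * eulerE (p ^ 2) * p ^ j * (p ^ 3) ^ (j * (j - 1) / 2)) * hsgn j
  · have e : (3 * j + 1) * (3 * j + 1 - 1) / 2 + (-3 * j ^ 2 - j)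
        = 2 * j + 3 * (j * (j - 1) / 2) := by
      have h1 := two_mul_ediv_mul_sub_one j
      have h2 := two_mul_ediv_mul_sub_one (3 * j + 1)
      linarith
    have e2 : p ^ ((3 * j + 1) * (3 * j + 1 - 1) / 2) * p ^ (-3 * j ^ 2 - j)
        = (p ^ 2) ^ j * (p ^ 3) ^ (j * (j - 1) / 2) := by
      rw [← zpow_add₀ hp0, e, zpow_add₀ hp0, zpow_mul, zpow_mul]; norm_cast
    rw [neg_neg, mul_zpow, neg_eq_neg_one_mul z, mul_zpow (-1), hpow3, zpow_add_one₀ hm1,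
      zpow_add_one₀ hz]
    linear_combination (-((-1) ^ (3 * j) * (-1) ^ j * z * z ^ (3 * j) * eulerE (p ^ 2))) * e2
      - (z * z ^ (3 * j) * eulerE (p ^ 2) * (p ^ 2) ^ j * (p ^ 3) ^ (j * (j - 1) / 2)) * hsgn j

/-- Split the pentagonal series by n = 5j + i. The leading exponents 0, 1, 5, 12, 22 are 0, 1, 0, 2,
2 modulo 5, so the five sums group into three sections; the symmetries of θ bring them to the shape
given by the quintuple product. -/
theorem eulerE_five_dissection {p : ℂ} (hp0 : p ≠ 0) (hp : ‖p‖ < 1) :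
    eulerE p = (jacobiSeries ((p ^ 5) ^ 8) ((p ^ 5) ^ 15)
          + p ^ 5 * jacobiSeries ((p ^ 5) ^ 13) ((p ^ 5) ^ 15))
        - p * eulerE (p ^ 25)
        - p ^ 2 * (jacobiSeries ((p ^ 5) ^ 11) ((p ^ 5) ^ 15)
          + p ^ 10 * jacobiSeries ((p ^ 5) ^ 16) ((p ^ 5) ^ 15)) := by
  have hm1 : (-1 : ℂ) ≠ 0 := by norm_num
  have hs : Summable fun n : ℤ => (-1) ^ n * p ^ (n + 3 * (n * (n - 1) / 2)) := by
    refine (summable_zpow_mul_zpow (pow_ne_zero 3 hp0) (norm_pow_lt_one hp three_ne_zero)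
      (-p)).congr fun n => ?_
    rw [neg_eq_neg_one_mul p, mul_zpow, zpow_add₀ hp0, zpow_mul, mul_assoc]; norm_cast
  have hE : eulerE p = ∑' n : ℤ, (-1) ^ n * p ^ (n + 3 * (n * (n - 1) / 2)) := by
    have := jacobiSeries_pow hp0 1 3
    rw [pow_one] at this
    rw [eulerE_eq_jacobiSeries hp0, this]
    simp
  have hres : ∀ i : ℕ, ∑' j : ℤ, (-1) ^ ((5 : ℕ) * j + i) * p ^ (((5 : ℕ) * j + i : ℤ)
      + 3 * (((5 : ℕ) * j + i : ℤ) * (((5 : ℕ) * j + i : ℤ) - 1) / 2))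
      = (-1) ^ i * p ^ (i + 3 * ((i : ℤ) * (i - 1) / 2)) * jacobiSeries (p ^ (35 + 15 * i)) (p ^ 75) := by
    intro i
    rw [jacobiSeries_pow hp0, ← tsum_mul_left]
    refine tsum_congr fun j => ?_
    have e : ((5 : ℕ) * j + i : ℤ) + 3 * (((5 : ℕ) * j + i : ℤ) * (((5 : ℕ) * j + i : ℤ) - 1) / 2)
        = (i + 3 * ((i : ℤ) * (i - 1) / 2))
          + (((35 + 15 * i : ℕ) : ℤ) * j + (75 : ℕ) * (j * (j - 1) / 2)) := by
      have h1 := two_mul_ediv_mul_sub_one j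
      have h2 := two_mul_ediv_mul_sub_one i
      have h3 := two_mul_ediv_mul_sub_one ((5 : ℕ) * j + i)
      push_cast at h3 ⊢
      linarith
    have hsgn : (-1 : ℂ) ^ (((5 : ℕ) : ℤ) * j + i) = (-1) ^ i * (-1) ^ j := by
      rw [zpow_add₀ hm1, zpow_mul, zpow_natCast]; norm_num [mul_comm]
    rw [e, zpow_add₀ hp0, hsgn]
    ring
  have hp5 := pow_ne_zero 5 hp0
  have hp75 := pow_ne_zero 75 hp0
  rw [hE, tsum_int_eq_sum_residues hs 5]
  simp only [hres, Finset.sum_range_succ, Finset.sum_range_zero]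
  have hdiv : ∀ a b : ℕ, p ^ (a + b) / p ^ a = p ^ b := fun a b => by
    rw [pow_add, mul_div_cancel_left₀ _ (pow_ne_zero a hp0)]
  have s0 := jacobiSeries_symm hp75 (pow_ne_zero 35 hp0)
  rw [hdiv 35 40] at s0
  have s1 := jacobiSeries_symm hp75 (pow_ne_zero 25 hp0)
  rw [hdiv 25 50] at s1
  have s2 := eulerE_eq_jacobiSeries (pow_ne_zero 25 hp0)
  rw [← pow_mul] at s2
  have s3 := jacobiSeries_symm hp75 (pow_ne_zero 20 hp0)
  rw [hdiv 20 55] at s3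
  have s4 := jacobiSeries_mul_left hp75 (pow_ne_zero 20 hp0)
  rw [← pow_add] at s4
  have r0 : ((0 : ℕ) : ℤ) + 3 * (((0 : ℕ) : ℤ) * (((0 : ℕ) : ℤ) - 1) / 2) = (0 : ℕ) := by norm_num
  have r1 : ((1 : ℕ) : ℤ) + 3 * (((1 : ℕ) : ℤ) * (((1 : ℕ) : ℤ) - 1) / 2) = (1 : ℕ) := by norm_num
  have r2 : ((2 : ℕ) : ℤ) + 3 * (((2 : ℕ) : ℤ) * (((2 : ℕ) : ℤ) - 1) / 2) = (5 : ℕ) := by norm_num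
  have r3 : ((3 : ℕ) : ℤ) + 3 * (((3 : ℕ) : ℤ) * (((3 : ℕ) : ℤ) - 1) / 2) = (12 : ℕ) := by norm_num
  have r4 : ((4 : ℕ) : ℤ) + 3 * (((4 : ℕ) : ℤ) * (((4 : ℕ) : ℤ) - 1) / 2) = (22 : ℕ) := by norm_num
  simp only [r0, r1, r2, r3, r4, zpow_natCast, ← pow_mul, Nat.reduceMul, Nat.reduceAdd] at s0 s1 s2 s3 s4 ⊢
  rw [s0, s2, ← s1, s3]
  linear_combination p ^ 2 * s4

theorem qShiftedFactorialInf_pow_split_two {q : ℂ} (hq : ‖q‖ < 1) (i m : ℕ) (hm : m ≠ 0) :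
    qShiftedFactorialInf (q ^ i) (q ^ m)
      = qShiftedFactorialInf (q ^ i) (q ^ (2 * m)) * qShiftedFactorialInf (q ^ (i + m)) (q ^ (2 * m)) := by
  rw [qShiftedFactorialInf_eq_prod (norm_pow_lt_one hq hm) _ two_ne_zero]
  simp only [Finset.prod_range_succ, Finset.prod_range_zero, one_mul, ← pow_mul, ← pow_add,
    mul_comm m 2, mul_zero, mul_one, add_zero]

theorem qShiftedFactorialInf_pow_mul_neg {q : ℂ} (hq : ‖q‖ < 1) (i m : ℕ) (hm : m ≠ 0) :
    qShiftedFactorialInf (q ^ i) (q ^ m) * qShiftedFactorialInf (-q ^ i) (q ^ m)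
      = qShiftedFactorialInf (q ^ (2 * i)) (q ^ (2 * m)) := by
  rw [qShiftedFactorialInf_mul_neg (norm_pow_lt_one hq hm), ← pow_mul, ← pow_mul, mul_comm i,
    mul_comm m]

theorem jacobiSeries_pow_eq_prod {q : ℂ} (hq0 : q ≠ 0) (hq : ‖q‖ < 1) (i j : ℕ) (h : i + j ≠ 0) :
    jacobiSeries (q ^ i) (q ^ (i + j)) = qShiftedFactorialInf (q ^ (i + j)) (q ^ (i + j))
      * qShiftedFactorialInf (q ^ i) (q ^ (i + j)) * qShiftedFactorialInf (q ^ j) (q ^ (i + j)) := by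
  rw [jacobi_tripleProduct (pow_ne_zero _ hq0) (norm_pow_lt_one hq h) (pow_ne_zero _ hq0)]
  congr 2
  rw [pow_add, mul_div_cancel_left₀ _ (pow_ne_zero _ hq0)]

theorem jacobiSeries_neg_pow_eq_prod {q : ℂ} (hq0 : q ≠ 0) (hq : ‖q‖ < 1) (i j : ℕ)
    (h : i + j ≠ 0) :
    jacobiSeries (-q ^ i) (q ^ (i + j)) = qShiftedFactorialInf (q ^ (i + j)) (q ^ (i + j))
      * qShiftedFactorialInf (-q ^ i) (q ^ (i + j))
      * qShiftedFactorialInf (-q ^ j) (q ^ (i + j)) := by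
  rw [jacobi_tripleProduct (pow_ne_zero _ hq0) (norm_pow_lt_one hq h)
    (neg_ne_zero.mpr (pow_ne_zero _ hq0))]
  congr 2
  rw [pow_add, div_neg, mul_div_cancel_left₀ _ (pow_ne_zero _ hq0)]

theorem eulerE_eq_prod_five {q : ℂ} (hq0 : q ≠ 0) (hq : ‖q‖ < 1) :
    eulerE q = qShiftedFactorialInf (q ^ 1) (q ^ 5) * qShiftedFactorialInf (q ^ 2) (q ^ 5)
      * qShiftedFactorialInf (q ^ 3) (q ^ 5) * qShiftedFactorialInf (q ^ 4) (q ^ 5)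
      * qShiftedFactorialInf (q ^ 5) (q ^ 5) := by
  rw [eulerE_eq_qShiftedFactorialInf hq0 hq, qShiftedFactorialInf_eq_prod hq q (m := 5) (by norm_num)]
  simp only [Finset.prod_range_succ, Finset.prod_range_zero, one_mul, ← pow_succ', zero_add,
    Nat.reduceAdd]

/-- The Rogers-Ramanujan identity for `G`. -/
theorem rogersG_mul_eulerE {q : ℂ} (hq0 : q ≠ 0) (hq : ‖q‖ < 1) :
    rogersG q * eulerE q = qShiftedFactorialInf (q ^ 5) (q ^ 5)
      * qShiftedFactorialInf (q ^ 2) (q ^ 5) * qShiftedFactorialInf (q ^ 3) (q ^ 5) := by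
  rw [eulerE_eq_qShiftedFactorialInf hq0 hq, rogersG_mul_qShiftedFactorialInf hq0 hq,
    jacobiSeries_pow_eq_prod hq0 hq 2 3 (by norm_num)]

/-- The Rogers-Ramanujan identity for `H`. -/
theorem rogersH_mul_eulerE {q : ℂ} (hq0 : q ≠ 0) (hq : ‖q‖ < 1) :
    rogersH q * eulerE q = qShiftedFactorialInf (q ^ 5) (q ^ 5)
      * qShiftedFactorialInf (q ^ 4) (q ^ 5) * qShiftedFactorialInf (q ^ 1) (q ^ 5) := by
  rw [eulerE_eq_qShiftedFactorialInf hq0 hq, rogersH_mul_qShiftedFactorialInf hq0 hq,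
    jacobiSeries_pow_eq_prod hq0 hq 4 1 (by norm_num)]

theorem rogersG_mul_rogersH {q : ℂ} (hq0 : q ≠ 0) (hq : ‖q‖ < 1) :
    rogersG q * rogersH q * eulerE q = eulerE (q ^ 5) := by
  have hE := eulerE_ne_zero hq0 hq
  have h5 := eulerE_eq_qShiftedFactorialInf (pow_ne_zero 5 hq0) (norm_pow_lt_one hq (by norm_num))
  apply mul_right_cancel₀ hE
  rw [h5]
  calc rogersG q * rogersH q * eulerE q * eulerE q
      = (rogersG q * eulerE q) * (rogersH q * eulerE q) := by ring
    _ = _ := by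
      rw [rogersG_mul_eulerE hq0 hq, rogersH_mul_eulerE hq0 hq, eulerE_eq_prod_five hq0 hq]; ring

/-- The algebra common to both sections. In the first one x = (q⁵;q⁵), y = (q¹⁰;q¹⁰), a and a' are
(q;q⁵) and (q⁴;q⁵), n and n' are their counterparts with −q and −q⁴, b and b' are (q²;q⁵) and
(q³;q⁵), while u, u', v, v' have base q¹⁰. The letter K stands for G or H. -/
theorem section_eq_of_products {T E K x y n n' a a' b b' u u' v v' : ℂ} (hE : E ≠ 0) (hy : y ≠ 0)
    (hQ : x * n * n' * (y * u * u') = y * T) (hv : a * n = v) (hv' : a' * n' = v')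
    (hb : b = v * u) (hb' : b' = u' * v') (hK : K * E = x * b * b') (hx : E = x * a * a' * b * b') :
    T = K ^ 2 * E := by
  apply mul_right_cancel₀ hE
  apply mul_left_cancel₀ hy
  calc y * (T * E) = (x * n * n' * (y * u * u')) * E := by rw [hQ]; ring
    _ = (x * n * n' * (y * u * u')) * (x * a * a' * b * b') := by rw [hx]
    _ = y * (x * b * b') * (x * ((a * n) * u) * (u' * (a' * n'))) := by ring
    _ = y * (K ^ 2 * E * E) := by rw [hv, hv', ← hb, ← hb', ← hK]; ring

/-- The quintuple product with base q⁵ at z = −q; the companion section uses z = −q². -/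
theorem eulerE_section_zero {q : ℂ} (hq0 : q ≠ 0) (hq : ‖q‖ < 1) :
    jacobiSeries (q ^ 8) (q ^ 15) + q * jacobiSeries (q ^ 13) (q ^ 15)
      = rogersG q ^ 2 * eulerE q := by
  have hE10 := eulerE_ne_zero (pow_ne_zero 10 hq0) (norm_pow_lt_one hq (m := 10) (by norm_num))
  have hQ := jacobiSeries_quintuple (pow_ne_zero 5 hq0) (norm_pow_lt_one hq (m := 5) (by norm_num))
    (z := -q ^ 1) (neg_ne_zero.mpr (pow_ne_zero 1 hq0))
  have e1 : (-q ^ 1) ^ 2 * q ^ 5 = q ^ 7 := by ring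
  have e2 : -((-q ^ 1) ^ 3 * q ^ 5) = q ^ 8 := by ring
  have e3 : -((-q ^ 1) ^ 3 * (q ^ 5) ^ 2) = q ^ 13 := by ring
  have t1 := jacobiSeries_neg_pow_eq_prod hq0 hq 1 4 (by norm_num)
  have t2 := jacobiSeries_pow_eq_prod hq0 hq 7 3 (by norm_num)
  have hE' := eulerE_eq_qShiftedFactorialInf (pow_ne_zero 10 hq0) (norm_pow_lt_one hq (by norm_num))
  rw [e1, e2, e3, ← pow_mul, ← pow_mul, t1, t2, hE'] at hQ
  rw [hE'] at hE10
  have hT : jacobiSeries (q ^ 8) (q ^ 15) + q * jacobiSeries (q ^ 13) (q ^ 15)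
      = jacobiSeries (q ^ 8) (q ^ (5 * 3)) - -q ^ 1 * jacobiSeries (q ^ 13) (q ^ (5 * 3)) := by
    ring
  rw [hT]
  exact section_eq_of_products (eulerE_ne_zero hq0 hq) hE10 hQ
    (qShiftedFactorialInf_pow_mul_neg hq 1 5 (by norm_num))
    (qShiftedFactorialInf_pow_mul_neg hq 4 5 (by norm_num))
    (qShiftedFactorialInf_pow_split_two hq 2 5 (by norm_num))
    (qShiftedFactorialInf_pow_split_two hq 3 5 (by norm_num))
    (rogersG_mul_eulerE hq0 hq) ((eulerE_eq_prod_five hq0 hq).trans (by ring))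

theorem eulerE_section_two {q : ℂ} (hq0 : q ≠ 0) (hq : ‖q‖ < 1) :
    jacobiSeries (q ^ 11) (q ^ 15) + q ^ 2 * jacobiSeries (q ^ 16) (q ^ 15)
      = rogersH q ^ 2 * eulerE q := by
  have hE10 := eulerE_ne_zero (pow_ne_zero 10 hq0) (norm_pow_lt_one hq (m := 10) (by norm_num))
  have hQ := jacobiSeries_quintuple (pow_ne_zero 5 hq0) (norm_pow_lt_one hq (m := 5) (by norm_num))
    (z := -q ^ 2) (neg_ne_zero.mpr (pow_ne_zero 2 hq0))
  have e1 : (-q ^ 2) ^ 2 * q ^ 5 = q ^ 9 := by ring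
  have e2 : -((-q ^ 2) ^ 3 * q ^ 5) = q ^ 11 := by ring
  have e3 : -((-q ^ 2) ^ 3 * (q ^ 5) ^ 2) = q ^ 16 := by ring
  have t1 := jacobiSeries_neg_pow_eq_prod hq0 hq 2 3 (by norm_num)
  have t2 := jacobiSeries_pow_eq_prod hq0 hq 9 1 (by norm_num)
  have hE' := eulerE_eq_qShiftedFactorialInf (pow_ne_zero 10 hq0) (norm_pow_lt_one hq (by norm_num))
  rw [e1, e2, e3, ← pow_mul, ← pow_mul, t1, t2, hE'] at hQ
  rw [hE'] at hE10
  have hT : jacobiSeries (q ^ 11) (q ^ 15) + q ^ 2 * jacobiSeries (q ^ 16) (q ^ 15)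
      = jacobiSeries (q ^ 11) (q ^ (5 * 3)) - -q ^ 2 * jacobiSeries (q ^ 16) (q ^ (5 * 3)) := by
    ring
  rw [hT]
  exact section_eq_of_products (eulerE_ne_zero hq0 hq) hE10 hQ
    (qShiftedFactorialInf_pow_mul_neg hq 2 5 (by norm_num))
    (qShiftedFactorialInf_pow_mul_neg hq 3 5 (by norm_num))
    (qShiftedFactorialInf_pow_split_two hq 4 5 (by norm_num))
    (qShiftedFactorialInf_pow_split_two hq 1 5 (by norm_num))
    (rogersH_mul_eulerE hq0 hq) ((eulerE_eq_prod_five hq0 hq).trans (by ring))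

/-- The `5`-dissection of Euler's function. -/
theorem eulerE_eq_rogers {p : ℂ} (hp0 : p ≠ 0) (hp : ‖p‖ < 1) :
    eulerE p = eulerE (p ^ 5) * (rogersG (p ^ 5) ^ 2 - p * rogersG (p ^ 5) * rogersH (p ^ 5)
      - p ^ 2 * rogersH (p ^ 5) ^ 2) := by
  have h5 := pow_ne_zero 5 hp0
  have h5' := norm_pow_lt_one hp (m := 5) (by norm_num)
  have h0 := eulerE_section_zero h5 h5'
  have h1 := rogersG_mul_rogersH h5 h5'
  have h2 := eulerE_section_two h5 h5'
  rw [← pow_mul] at h1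
  rw [← pow_mul p 5 2] at h2
  rw [eulerE_five_dissection hp0 hp, h0, h2, ← h1]
  ring

/-! ### Form series and the Hecke operator T₅ -/

/-- With y a K-th root of q, the term q^N = y^(KN) is dominated by the product of ‖y‖^(n²) and
‖y‖^(m²). -/
theorem summable_zpow_of_sq_add_sq_le {q : ℂ} (hq0 : q ≠ 0) (hq : ‖q‖ < 1) {N : ℤ × ℤ → ℤ} {K : ℕ}
    (hK : K ≠ 0) (hN : ∀ v : ℤ × ℤ, v.1 ^ 2 + v.2 ^ 2 ≤ K * N v) :
    Summable fun v => q ^ N v := by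
  obtain ⟨y, rfl⟩ := IsAlgClosed.exists_pow_nat_eq q (Nat.pos_of_ne_zero hK)
  have hy0 : y ≠ 0 := fun h => hq0 (by rw [h, zero_pow hK])
  have hy : ‖y‖ < 1 := by
    rw [norm_pow] at hq
    exact (pow_lt_one_iff_of_nonneg (norm_nonneg y) hK).mp hq
  have h1 : Summable fun n : ℤ => ‖y ^ (n ^ 2)‖ := by
    refine ((summable_zpow_mul_zpow (pow_ne_zero 2 hy0) (norm_pow_lt_one hy two_ne_zero)
      y).congr fun n => ?_).norm
    rw [← zpow_natCast y 2, ← zpow_mul, ← zpow_add₀ hy0]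
    congr 1
    push_cast
    rw [two_mul_ediv_mul_sub_one]
    ring
  refine Summable.of_norm_bounded (h1.mul_of_nonneg h1 (fun _ => norm_nonneg _)
    fun _ => norm_nonneg _) fun v => ?_
  rw [← norm_mul, ← zpow_add₀ hy0, norm_zpow, norm_zpow, norm_pow, ← zpow_natCast ‖y‖, ← zpow_mul]
  exact zpow_le_zpow_right_of_le_one₀ (norm_pos_iff.mpr hy0) hy.le (hN v)

theorem tsum_ite_eq_tsum_comp {ι κ : Type*} {P : κ → Prop} [DecidablePred P] {F : κ → ℂ}
    {e : ι → κ} (he : Function.Injective e) (hP : ∀ v, P v → F v ≠ 0 → v ∈ Set.range e)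
    (hP' : ∀ x, P (e x)) : ∑' v, (if P v then F v else 0) = ∑' x, F (e x) := by
  rw [← he.tsum_eq]
  · exact tsum_congr fun x => if_pos (hP' x)
  · intro v hv
    by_cases h : P v
    · refine hP v h fun h0 => hv ?_
      simp [h0]
    · exact absurd (if_neg h) hv

/-- Together with the swap and the sign change, these unimodular substitutions bring every form met
below to its named representative. -/
theorem formSeries_shear (k a b c : ℤ) (q : ℂ) :
    formSeries a b c q = formSeries a (b + 2 * a * k) (a * k ^ 2 + b * k + c) q := by
  set φ : ℤ × ℤ ≃ ℤ × ℤ :=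
    { toFun := fun x => (x.1 + k * x.2, x.2)
      invFun := fun x => (x.1 - k * x.2, x.2)
      left_inv := fun x => by simp
      right_inv := fun x => by simp } with hφ
  rw [formSeries, ← φ.tsum_eq]
  refine tsum_congr fun x => ?_
  congr 1
  simp only [hφ, Equiv.coe_fn_mk]
  ring

theorem formSeries_swap (a b c : ℤ) (q : ℂ) : formSeries a b c q = formSeries c b a q := by
  rw [formSeries, ← (Equiv.prodComm ℤ ℤ).tsum_eq]
  refine tsum_congr fun x => ?_
  congr 1
  simp only [Equiv.prodComm_apply, Prod.fst_swap, Prod.snd_swap]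
  ring

theorem formSeries_neg (a b c : ℤ) (q : ℂ) : formSeries a b c q = formSeries a (-b) c q := by
  rw [formSeries, ← ((Equiv.refl ℤ).prodCongr (Equiv.neg ℤ)).tsum_eq]
  refine tsum_congr fun x => ?_
  congr 1
  simp only [Equiv.prodCongr_apply, Prod.map_fst, Prod.map_snd, Equiv.refl_apply, Equiv.neg_apply]
  ring

theorem sum_pow_rotate_five {ζ : ℂ} (hζ : IsPrimitiveRoot ζ 5) (k : ℤ) :
    ∑ j ∈ Finset.range 5, (ζ ^ j) ^ k = if 5 ∣ k then 5 else 0 := by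
  have h1 : ∀ j : ℕ, (ζ ^ j) ^ k = (ζ ^ k) ^ j := fun j => by
    rw [← zpow_natCast, ← zpow_natCast, ← zpow_mul, ← zpow_mul, mul_comm]
  simp_rw [h1]
  have hd := hζ.zpow_eq_one_iff_dvd k
  push_cast at hd
  split_ifs with h
  · rw [hd.mpr h]; simp
  · have h2 : ζ ^ k ≠ 1 := fun h' => h (hd.mp h')
    have h3 := geom_sum_eq h2 5
    rw [h3, ← zpow_natCast, ← zpow_mul, mul_comm, zpow_mul, zpow_natCast, hζ.pow_eq_one]
    simp

/-- Averaging over the five rotations of the variable selects the exponents divisible by `5`. -/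
theorem sum_rotate_formSeries {p ζ : ℂ} (hp0 : p ≠ 0) (hp : ‖p‖ < 1) (hζ : IsPrimitiveRoot ζ 5)
    {a b c : ℤ} {K : ℕ} (hK : K ≠ 0)
    (hN : ∀ v : ℤ × ℤ, v.1 ^ 2 + v.2 ^ 2 ≤ K * (a * v.1 ^ 2 + b * v.1 * v.2 + c * v.2 ^ 2)) :
    ∑ j ∈ Finset.range 5, formSeries a b c (ζ ^ j * p)
      = 5 * ∑' v : ℤ × ℤ, if (5 : ℤ) ∣ a * v.1 ^ 2 + b * v.1 * v.2 + c * v.2 ^ 2 then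
          p ^ (a * v.1 ^ 2 + b * v.1 * v.2 + c * v.2 ^ 2) else 0 := by
  have hζ0 : ζ ≠ 0 := hζ.ne_zero (by norm_num)
  have hζn : ‖ζ‖ = 1 := hζ.norm'_eq_one (by norm_num)
  simp only [formSeries]
  rw [← Summable.tsum_finsetSum fun j _ => summable_zpow_of_sq_add_sq_le
    (mul_ne_zero (pow_ne_zero j hζ0) hp0) (by simpa [hζn] using hp) hK hN, ← tsum_mul_left]
  refine tsum_congr fun v => ?_
  simp_rw [mul_zpow]
  rw [← Finset.sum_mul, sum_pow_rotate_five hζ]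
  split_ifs <;> simp

/-- The action of the Hecke operator `T₅` on the generating function of a binary quadratic form
`a n² + b n m + c m² ≡ c (m - r₁ n) (m - r₂ n) (mod 5)`. -/
theorem sum_rotate_formSeries_add {p ζ : ℂ} (hp0 : p ≠ 0) (hp : ‖p‖ < 1) (hζ : IsPrimitiveRoot ζ 5)
    {a b c : ℤ} {K : ℕ} (hK : K ≠ 0)
    (hN : ∀ v : ℤ × ℤ, v.1 ^ 2 + v.2 ^ 2 ≤ K * (a * v.1 ^ 2 + b * v.1 * v.2 + c * v.2 ^ 2))
    (r₁ r₂ a₁ a₂ : ℤ) (h₁ : a + b * r₁ + c * r₁ ^ 2 = 5 * a₁)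
    (h₂ : a + b * r₂ + c * r₂ ^ 2 = 5 * a₂) (hc : ¬ (5 : ℤ) ∣ c) (hr : ¬ (5 : ℤ) ∣ r₁ - r₂)
    (hb : (5 : ℤ) ∣ b + c * (r₁ + r₂)) (ha : (5 : ℤ) ∣ a - c * (r₁ * r₂)) :
    (∑ j ∈ Finset.range 5, formSeries a b c (ζ ^ j * p)) / 5 + formSeries a b c (p ^ 25)
      = formSeries a₁ (b + 2 * c * r₁) (5 * c) (p ^ 5)
        + formSeries a₂ (b + 2 * c * r₂) (5 * c) (p ^ 5) := by
  have hprime : Prime (5 : ℤ) := by norm_num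
  set N : ℤ × ℤ → ℤ := fun v => a * v.1 ^ 2 + b * v.1 * v.2 + c * v.2 ^ 2 with hNdef
  have hs : Summable fun v => p ^ N v := summable_zpow_of_sq_add_sq_le hp0 hp hK hN
  -- Modulo 5 the form is a product of two distinct linear factors, so 5 ∣ N cuts out two
  -- sublattices of index 5 that meet in 5ℤ².
  have hdiv : ∀ v : ℤ × ℤ, 5 ∣ N v ↔ 5 ∣ v.2 - r₁ * v.1 ∨ 5 ∣ v.2 - r₂ * v.1 := fun v => by
    have h : N v = c * ((v.2 - r₁ * v.1) * (v.2 - r₂ * v.1))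
        + ((a - c * (r₁ * r₂)) * v.1 ^ 2 + (b + c * (r₁ + r₂)) * (v.1 * v.2)) := by
      simp only [hNdef]; ring
    rw [h, dvd_add_left (dvd_add (ha.mul_right _) (hb.mul_right _)), hprime.dvd_mul,
      hprime.dvd_mul]
    tauto
  have hline : ∀ r a' : ℤ, a + b * r + c * r ^ 2 = 5 * a' →
      ∑' v : ℤ × ℤ, (if 5 ∣ v.2 - r * v.1 then p ^ N v else 0)
        = formSeries a' (b + 2 * c * r) (5 * c) (p ^ 5) := fun r a' h => by
    rw [tsum_ite_eq_tsum_comp (e := fun x : ℤ × ℤ => (x.1, r * x.1 + 5 * x.2))]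
    · refine tsum_congr fun x => ?_
      rw [← zpow_natCast, ← zpow_mul]
      congr 1
      simp only [hNdef]
      push_cast
      linear_combination x.1 ^ 2 * h
    · rintro ⟨x, y⟩ ⟨x', y'⟩ h
      simp only [Prod.mk.injEq] at h ⊢
      obtain ⟨rfl, h⟩ := h
      exact ⟨rfl, by omega⟩
    · rintro ⟨n, m⟩ ⟨k, hk⟩ -
      exact ⟨(n, k), by simp only [Prod.mk.injEq, true_and]; linarith⟩
    · intro x
      exact ⟨x.2, by ring⟩
  have hboth : ∑' v : ℤ × ℤ, (if 5 ∣ v.2 - r₁ * v.1 ∧ 5 ∣ v.2 - r₂ * v.1 then p ^ N v else 0)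
      = formSeries a b c (p ^ 25) := by
    rw [tsum_ite_eq_tsum_comp (e := fun x : ℤ × ℤ => (5 * x.1, 5 * x.2))]
    · refine tsum_congr fun x => ?_
      rw [← zpow_natCast, ← zpow_mul]
      congr 1
      simp only [hNdef]
      push_cast
      ring
    · rintro ⟨x, y⟩ ⟨x', y'⟩ h
      simp only [Prod.mk.injEq] at h ⊢
      omega
    · rintro ⟨n, m⟩ ⟨h1, h2⟩ -
      simp only at h1 h2
      have h3 : (5 : ℤ) ∣ (r₁ - r₂) * n := by
        have := dvd_sub h2 h1
        rwa [show m - r₂ * n - (m - r₁ * n) = (r₁ - r₂) * n by ring] at this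
      obtain ⟨x, rfl⟩ := (hprime.dvd_or_dvd h3).resolve_left hr
      obtain ⟨y, hy⟩ := h1
      exact ⟨(x, y + r₁ * x), by simp only [Prod.mk.injEq, true_and]; linarith⟩
    · intro x
      exact ⟨⟨x.2 - r₁ * x.1, by ring⟩, ⟨x.2 - r₂ * x.1, by ring⟩⟩
  rw [sum_rotate_formSeries hp0 hp hζ hK hN, mul_div_cancel_left₀ _ (by norm_num), ← hline r₁ a₁ h₁,
    ← hline r₂ a₂ h₂, ← hboth]
  have hsi : ∀ P : ℤ × ℤ → Prop, ∀ [DecidablePred P],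
      Summable fun v => if P v then p ^ N v else 0 := fun P _ => by
    refine (hs.indicator {v | P v}).congr fun v => ?_
    simp [Set.indicator_apply]
  -- Inclusion–exclusion: union plus intersection equals the sum of the two sublattices.
  rw [← (hsi _).tsum_add (hsi _), ← (hsi _).tsum_add (hsi _)]
  refine tsum_congr fun v => ?_
  have hd := hdiv v
  simp only [hNdef] at hd ⊢
  by_cases c1 : 5 ∣ v.2 - r₁ * v.1 <;> by_cases c2 : 5 ∣ v.2 - r₂ * v.1 <;> simp [hd, c1, c2]

/-! ### Products of two Euler functions as differences of form series -/

theorem eulerE_pow_eq_tsum {q : ℂ} (hq0 : q ≠ 0) (hq : ‖q‖ < 1) {M : ℕ} (hM : M ≠ 0) :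
    Summable (fun n : ℤ => ‖(-1 : ℂ) ^ n * q ^ (M * (n + 3 * (n * (n - 1) / 2)))‖) ∧
    eulerE (q ^ M) = ∑' n : ℤ, (-1 : ℂ) ^ n * q ^ (M * (n + 3 * (n * (n - 1) / 2))) := by
  have hterm : ∀ n : ℤ, (-q ^ M) ^ n * ((q ^ M) ^ 3) ^ (n * (n - 1) / 2)
      = (-1 : ℂ) ^ n * q ^ (M * (n + 3 * (n * (n - 1) / 2))) := fun n => by
    rw [neg_eq_neg_one_mul, mul_zpow, mul_add, zpow_add₀ hq0, zpow_mul, zpow_mul, zpow_mul,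
      zpow_natCast, mul_assoc]
    norm_cast
  refine ⟨((summable_zpow_mul_zpow (pow_ne_zero 3 (pow_ne_zero M hq0)) (norm_pow_lt_one
    (norm_pow_lt_one hq hM) three_ne_zero) (-q ^ M)).congr hterm).norm, ?_⟩
  rw [eulerE_eq_jacobiSeries (pow_ne_zero M hq0)]
  exact tsum_congr hterm

/-- A product of two Euler functions as a difference of generating functions of binary quadratic
forms. -/
theorem formSeries_sub_eq_eulerE_mul {q : ℂ} (hq0 : q ≠ 0) (hq : ‖q‖ < 1) {A B c K : ℕ}
    (hA : A ≠ 0) (hB : B ≠ 0) (hAB : A + B = 8 * c) (hK : K ≠ 0)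
    (hN : ∀ v : ℤ × ℤ, v.1 ^ 2 + v.2 ^ 2 ≤ K * (c * v.1 ^ 2 + A * v.1 * v.2 + 2 * A * v.2 ^ 2)) :
    formSeries c (3 * A) (18 * A) q - formSeries (c + 3 * A) (15 * A) (18 * A) q
      = 2 * q ^ c * eulerE (q ^ (3 * A)) * eulerE (q ^ (3 * B)) := by
  set N : ℤ × ℤ → ℤ := fun v => c * v.1 ^ 2 + A * v.1 * v.2 + 2 * A * v.2 ^ 2 with hNdef
  have hs : Summable fun v => q ^ N v := summable_zpow_of_sq_add_sq_le hq0 hq hK hN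
  have hsi : ∀ P : ℤ × ℤ → Prop, ∀ [DecidablePred P],
      Summable fun v => if P v then q ^ N v else 0 := fun P _ => by
    refine (hs.indicator {v | P v}).congr fun v => ?_
    simp [Set.indicator_apply]
  set F : ℤ × ℤ → ℂ := fun v => (if 3 ∣ v.2 then q ^ N v else 0)
    - (if 3 ∣ v.2 - v.1 then q ^ N v else 0) with hF
  have hFs : Summable F := (hsi _).sub (hsi _)
  have hFi : ∀ P : ℤ × ℤ → Prop, ∀ [DecidablePred P],
      Summable fun v => if P v then F v else 0 := fun P _ => by
    refine (hFs.indicator {v | P v}).congr fun v => ?_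
    simp [Set.indicator_apply]
  have hleft : formSeries c (3 * A) (18 * A) q - formSeries (c + 3 * A) (15 * A) (18 * A) q
      = ∑' v, F v := by
    rw [(hsi _).tsum_sub (hsi _), tsum_ite_eq_tsum_comp (e := fun x : ℤ × ℤ => (x.1, 3 * x.2)),
      tsum_ite_eq_tsum_comp (e := fun x : ℤ × ℤ => (x.1, x.1 + 3 * x.2))]
    · congr 1 <;> refine tsum_congr fun x => ?_
      · congr 1; simp only [hNdef]; ring
      · congr 1; simp only [hNdef]; ring
    · rintro ⟨x, y⟩ ⟨x', y'⟩ h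
      simp only [Prod.mk.injEq] at h ⊢
      omega
    · rintro ⟨n, m⟩ ⟨k, hk⟩ -
      exact ⟨(n, k), by simp only [Prod.mk.injEq, true_and]; linarith⟩
    · exact fun x => ⟨x.2, by ring⟩
    · rintro ⟨x, y⟩ ⟨x', y'⟩ h
      simp only [Prod.mk.injEq] at h ⊢
      omega
    · rintro ⟨n, m⟩ ⟨k, hk⟩ -
      exact ⟨(n, k), by simp only [Prod.mk.injEq, true_and]; linarith⟩
    · exact fun x => ⟨x.2, rfl⟩
  -- For even n the reflection (n, t) ↦ (−n, t + n/2) is integral. It fixes n + 4t, hence N, and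
  -- exchanges the two sublattices.
  have heven : ∑' v : ℤ × ℤ, (if v.1 % 2 = 0 then F v else 0) = 0 := by
    rw [tsum_ite_eq_tsum_comp (e := fun x : ℤ × ℤ => (2 * x.1, x.2))]
    · set φ : ℤ × ℤ ≃ ℤ × ℤ :=
        { toFun := fun x => (-x.1, x.2 + x.1)
          invFun := fun x => (-x.1, x.2 + x.1)
          left_inv := fun x => by simp
          right_inv := fun x => by simp } with hφ
      have h : ∑' x : ℤ × ℤ, F (2 * x.1, x.2) = -∑' x : ℤ × ℤ, F (2 * x.1, x.2) := by
        conv_lhs => rw [← φ.tsum_eq]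
        rw [← tsum_neg]
        refine tsum_congr fun x => ?_
        have hN1 : N (2 * (φ x).1, (φ x).2) = N (2 * x.1, x.2) := by
          simp only [hNdef, hφ, Equiv.coe_fn_mk]; ring
        have d1 : (3 : ℤ) ∣ (φ x).2 ↔ 3 ∣ x.2 - 2 * x.1 := by
          simp only [hφ, Equiv.coe_fn_mk]; omega
        have d2 : (3 : ℤ) ∣ (φ x).2 - 2 * (φ x).1 ↔ 3 ∣ x.2 := by
          simp only [hφ, Equiv.coe_fn_mk]; omega
        simp only [hF, hN1, d1, d2, neg_sub]
      exact self_eq_neg.mp h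
    · rintro ⟨x, y⟩ ⟨x', y'⟩ h
      simp only [Prod.mk.injEq] at h ⊢
      omega
    · rintro ⟨n, m⟩ h -
      simp only at h
      exact ⟨(n / 2, m), by simp only [Prod.mk.injEq, and_true]; omega⟩
    · intro x
      simp only
      omega
  have hneg : ∑' v : ℤ × ℤ, (if v.1 % 6 = 1 then F v else 0)
      = ∑' v : ℤ × ℤ, (if v.1 % 6 = 5 then F v else 0) := by
    rw [← (Equiv.neg (ℤ × ℤ)).tsum_eq]
    refine tsum_congr fun v => ?_
    have hN1 : N (-v) = N v := by simp only [hNdef, Prod.fst_neg, Prod.snd_neg]; ring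
    have d0 : (-v).1 % 6 = 1 ↔ v.1 % 6 = 5 := by simp only [Prod.fst_neg]; omega
    have d1 : (3 : ℤ) ∣ (-v).2 ↔ 3 ∣ v.2 := by simp only [Prod.snd_neg]; omega
    have d2 : (3 : ℤ) ∣ (-v).2 - (-v).1 ↔ 3 ∣ v.2 - v.1 := by
      simp only [Prod.fst_neg, Prod.snd_neg]; omega
    simp only [Equiv.neg_apply, hF, hN1, d0, d1, d2]
  have hmain : ∑' v : ℤ × ℤ, (if v.1 % 6 = 5 then F v else 0)
      = q ^ c * eulerE (q ^ (3 * A)) * eulerE (q ^ (3 * B)) := by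
    obtain ⟨sA, eA⟩ := eulerE_pow_eq_tsum hq0 hq (M := 3 * A) (by omega)
    obtain ⟨sB, eB⟩ := eulerE_pow_eq_tsum hq0 hq (M := 3 * B) (by omega)
    -- Here n = 6b−1, and t solves n + 4t = 6a−1 if a + b is even, n + 4t = −(6a−1) if it is odd.
    -- These cases are 3 ∣ t and 3 ∣ t−n respectively, so the sign in F is (−1)^(a+b).
    rw [tsum_ite_eq_tsum_comp (e := fun x : ℤ × ℤ => (6 * x.2 - 1,
      if (x.1 + x.2) % 2 = 0 then 3 * ((x.1 - x.2) / 2) else (1 - 3 * (x.1 + x.2)) / 2)), mul_assoc,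
      eA, eB, tsum_mul_tsum_of_summable_norm sA sB, ← tsum_mul_left]
    · refine tsum_congr fun x => ?_
      obtain ⟨a, b⟩ := x
      have hm1 : (-1 : ℂ) ≠ 0 := by norm_num
      have hexp : ∀ t : ℤ, (6 * b - 1 + 4 * t) ^ 2 = (6 * a - 1) ^ 2 → N (6 * b - 1, t)
          = c + ((3 * A : ℕ) * (a + 3 * (a * (a - 1) / 2))
            + (3 * B : ℕ) * (b + 3 * (b * (b - 1) / 2))) := fun t ht => by
        have h1 := two_mul_ediv_mul_sub_one a
        have h2 := two_mul_ediv_mul_sub_one b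
        have h3 : (A : ℤ) + B = 8 * c := by exact_mod_cast hAB
        -- This uses 8N = A(n+4t)² + Bn² and (6a−1)² = 1 + 12a(3a−1)/1, the latter being 1 plus 24
        -- times a pentagonal number.
        have h4 : 8 * N (6 * b - 1, t) = 8 * (c + ((3 * A : ℕ) * (a + 3 * (a * (a - 1) / 2))
            + (3 * B : ℕ) * (b + 3 * (b * (b - 1) / 2)))) := by
          simp only [hNdef]
          push_cast
          linear_combination (A : ℤ) * ht - 36 * A * h1 - 36 * B * h2
            - ((6 * b - 1) ^ 2 - 1) * h3
        linarith
      have hpow : ∀ t : ℤ, (6 * b - 1 + 4 * t) ^ 2 = (6 * a - 1) ^ 2 →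
          q ^ c * ((-1) ^ a * q ^ ((3 * A : ℕ) * (a + 3 * (a * (a - 1) / 2)))
            * ((-1) ^ b * q ^ ((3 * B : ℕ) * (b + 3 * (b * (b - 1) / 2)))))
          = (-1) ^ (a + b) * q ^ N (6 * b - 1, t) := fun t ht => by
        rw [hexp t ht, zpow_add₀ hq0, zpow_add₀ hq0, zpow_add₀ hm1, zpow_natCast]
        ring
      simp only
      split_ifs with h
      · rw [hpow (3 * ((a - b) / 2)) (by rw [show 6 * b - 1 + 4 * (3 * ((a - b) / 2)) = 6 * a - 1 by omega])]
        have d1 : (3 : ℤ) ∣ 3 * ((a - b) / 2) := ⟨_, rfl⟩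
        have d2 : ¬ (3 : ℤ) ∣ 3 * ((a - b) / 2) - (6 * b - 1) := by omega
        rw [(Int.even_iff.mpr h).neg_one_zpow]
        simp only [hF, d1, d2, if_true, if_false]
        ring
      · rw [hpow ((1 - 3 * (a + b)) / 2) (by
          rw [show 6 * b - 1 + 4 * ((1 - 3 * (a + b)) / 2) = -(6 * a - 1) by omega, neg_sq])]
        have d1 : ¬ (3 : ℤ) ∣ (1 - 3 * (a + b)) / 2 := by omega
        have d2 : (3 : ℤ) ∣ (1 - 3 * (a + b)) / 2 - (6 * b - 1) := by omega
        rw [(Int.odd_iff.mpr (by omega : (a + b) % 2 = 1)).neg_one_zpow]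
        simp only [hF, d1, d2, if_true, if_false]
        ring
    · rintro ⟨x, y⟩ ⟨x', y'⟩ h
      simp only [Prod.mk.injEq] at h ⊢
      obtain ⟨h1, h2⟩ := h
      split_ifs at h2 <;> omega
    · rintro ⟨n, t⟩ h hne
      simp only at h
      have hd : (3 : ℤ) ∣ t ∨ (3 : ℤ) ∣ t - n := by
        by_contra hcon
        push Not at hcon
        exact hne (by simp [hF, hcon.1, hcon.2])
      by_cases h3 : (3 : ℤ) ∣ t
      · refine ⟨((n + 1) / 6 + 2 * (t / 3), (n + 1) / 6), ?_⟩
        simp only [Prod.mk.injEq]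
        rw [if_pos (by omega)]
        omega
      · refine ⟨(-2 * (t / 3) - 1 - (n + 1) / 6, (n + 1) / 6), ?_⟩
        simp only [Prod.mk.injEq]
        rw [if_neg (by omega)]
        omega
    · intro x
      simp only
      omega
  have hsplit : ∑' v, F v = ∑' v : ℤ × ℤ, (if v.1 % 2 = 0 then F v else 0)
      + ∑' v : ℤ × ℤ, (if v.1 % 6 = 5 then F v else 0)
      + ∑' v : ℤ × ℤ, (if v.1 % 6 = 1 then F v else 0) := by
    rw [← (hFi _).tsum_add (hFi _), ← ((hFi _).add (hFi _)).tsum_add (hFi _)]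
    refine tsum_congr fun v => ?_
    by_cases c2 : v.1 % 2 = 0
    · simp [c2, show ¬ v.1 % 6 = 5 by omega, show ¬ v.1 % 6 = 1 by omega]
    by_cases c5 : v.1 % 6 = 5
    · simp [c5, c2]
    by_cases c1 : v.1 % 6 = 1
    · simp [c1, c2]
    -- Only n ≡ 3 (mod 6) is left, where the two sublattice conditions coincide and F vanishes.
    have hd : (3 : ℤ) ∣ v.2 - v.1 ↔ 3 ∣ v.2 := by omega
    simp [c1, c2, c5, hF, hd]
  rw [hleft, hsplit, heven, hneg, hmain]
  ring

/-! ### Discriminant −351: the four series identities -/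

theorem sum_rotate_pow {ζ : ℂ} (hζ : IsPrimitiveRoot ζ 5) (p : ℂ) (k : ℕ) :
    ∑ j ∈ Finset.range 5, (ζ ^ j * p) ^ k = if 5 ∣ k then 5 * p ^ k else 0 := by
  have h := sum_pow_rotate_five hζ k
  simp only [zpow_natCast] at h
  simp_rw [mul_pow]
  rw [← Finset.sum_mul, h]
  by_cases hk : 5 ∣ k
  · rw [if_pos hk, if_pos (by omega)]
  · rw [if_neg hk, if_neg (by omega), zero_mul]

/-- Euler's function at a rotated argument, in terms of Rogers-Ramanujan functions that do not
depend on the rotation. -/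
theorem eulerE_rotate_pow {p ζ : ℂ} (hp0 : p ≠ 0) (hp : ‖p‖ < 1) (hζ : IsPrimitiveRoot ζ 5)
    (j : ℕ) {r : ℕ} (hr : r ≠ 0) :
    eulerE ((ζ ^ j * p) ^ r) = eulerE ((p ^ 5) ^ r) * (rogersG ((p ^ 5) ^ r) ^ 2
      - (ζ ^ j * p) ^ r * rogersG ((p ^ 5) ^ r) * rogersH ((p ^ 5) ^ r)
      - ((ζ ^ j * p) ^ r) ^ 2 * rogersH ((p ^ 5) ^ r) ^ 2) := by
  have hζ0 : ζ ≠ 0 := hζ.ne_zero (by norm_num)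
  have hζn : ‖ζ‖ = 1 := hζ.norm'_eq_one (by norm_num)
  have h1 : ‖ζ ^ j * p‖ < 1 := by simpa [hζn] using hp
  have h2 : ((ζ ^ j * p) ^ r) ^ 5 = (p ^ 5) ^ r := by
    rw [show ((ζ ^ j * p) ^ r) ^ 5 = ((ζ ^ 5) ^ j * p ^ 5) ^ r by ring, hζ.pow_eq_one, one_pow,
      one_mul]
  rw [eulerE_eq_rogers (pow_ne_zero r (mul_ne_zero (pow_ne_zero j hζ0) hp0))
    (norm_pow_lt_one h1 hr), h2]

theorem formSeries_zero {a b c : ℤ} {K : ℕ}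
    (hN : ∀ v : ℤ × ℤ, v.1 ^ 2 + v.2 ^ 2 ≤ K * (a * v.1 ^ 2 + b * v.1 * v.2 + c * v.2 ^ 2)) :
    formSeries a b c 0 = 1 := by
  rw [formSeries, tsum_eq_single 0]
  · simp
  · intro v hv
    refine zero_zpow _ fun h => hv ?_
    have h1 := hN v
    rw [h, mul_zero] at h1
    exact Prod.ext (by simp only [Prod.fst_zero]; nlinarith [sq_nonneg v.1, sq_nonneg v.2])
      (by simp only [Prod.snd_zero]; nlinarith [sq_nonneg v.1, sq_nonneg v.2])

theorem formBound_1_1_88 (v : ℤ × ℤ) :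
    v.1 ^ 2 + v.2 ^ 2 ≤ (2 : ℕ) * (1 * v.1 ^ 2 + 1 * v.1 * v.2 + 88 * v.2 ^ 2) := by
  push_cast; nlinarith [sq_nonneg (v.1 + v.2), sq_nonneg v.2]

theorem formBound_2_1_44 (v : ℤ × ℤ) :
    v.1 ^ 2 + v.2 ^ 2 ≤ (2 : ℕ) * (2 * v.1 ^ 2 + 1 * v.1 * v.2 + 44 * v.2 ^ 2) := by
  push_cast; nlinarith [sq_nonneg (v.1 + v.2), sq_nonneg v.2, sq_nonneg v.1]

theorem formBound_4_1_22 (v : ℤ × ℤ) :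
    v.1 ^ 2 + v.2 ^ 2 ≤ (2 : ℕ) * (4 * v.1 ^ 2 + 1 * v.1 * v.2 + 22 * v.2 ^ 2) := by
  push_cast; nlinarith [sq_nonneg (v.1 + v.2), sq_nonneg v.2, sq_nonneg v.1]

theorem formBound_8_1_11 (v : ℤ × ℤ) :
    v.1 ^ 2 + v.2 ^ 2 ≤ (2 : ℕ) * (8 * v.1 ^ 2 + 1 * v.1 * v.2 + 11 * v.2 ^ 2) := by
  push_cast; nlinarith [sq_nonneg (v.1 + v.2), sq_nonneg v.2, sq_nonneg v.1]

theorem formBound_9_3_10 (v : ℤ × ℤ) :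
    v.1 ^ 2 + v.2 ^ 2 ≤ (2 : ℕ) * (9 * v.1 ^ 2 + 3 * v.1 * v.2 + 10 * v.2 ^ 2) := by
  push_cast; nlinarith [sq_nonneg (v.1 + v.2), sq_nonneg v.2, sq_nonneg v.1]

theorem formBound_5_3_18 (v : ℤ × ℤ) :
    v.1 ^ 2 + v.2 ^ 2 ≤ (2 : ℕ) * (5 * v.1 ^ 2 + 3 * v.1 * v.2 + 18 * v.2 ^ 2) := by
  push_cast; nlinarith [sq_nonneg (v.1 + v.2), sq_nonneg v.2, sq_nonneg v.1]

theorem formBound_10_7_10 (v : ℤ × ℤ) :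
    v.1 ^ 2 + v.2 ^ 2 ≤ (2 : ℕ) * (10 * v.1 ^ 2 + 7 * v.1 * v.2 + 10 * v.2 ^ 2) := by
  push_cast; nlinarith [sq_nonneg (v.1 + v.2), sq_nonneg v.2, sq_nonneg v.1]

theorem formSeries_2_1_44_sub {q : ℂ} (hq0 : q ≠ 0) (hq : ‖q‖ < 1) :
    formSeries 2 1 44 q - formSeries 8 1 11 q = 2 * q ^ 2 * eulerE (q ^ 9) * eulerE (q ^ 39) := by
  have h := formSeries_sub_eq_eulerE_mul hq0 hq (A := 3) (B := 13) (c := 2) (K := 2) (by norm_num)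
    (by norm_num) (by norm_num) (by norm_num) fun v => by
      push_cast; nlinarith [sq_nonneg (v.1 + v.2), sq_nonneg v.2, sq_nonneg v.1]
  have h1 := formSeries_shear (-2) 2 9 54 q
  have h2 := formSeries_shear (-2) 11 45 54 q
  norm_num at h h1 h2
  rw [h1, h2, formSeries_swap 11] at h
  exact h

theorem formSeries_5_3_18_sub {q : ℂ} (hq0 : q ≠ 0) (hq : ‖q‖ < 1) :
    formSeries 5 3 18 q - formSeries 8 1 11 q = 2 * q ^ 5 * eulerE (q ^ 3) * eulerE (q ^ 117) := by
  have h := formSeries_sub_eq_eulerE_mul hq0 hq (A := 1) (B := 39) (c := 5) (K := 2) (by norm_num)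
    (by norm_num) (by norm_num) (by norm_num) fun v => by
      push_cast; nlinarith [sq_nonneg (v.1 + v.2), sq_nonneg v.2, sq_nonneg v.1]
  have h2 := formSeries_shear (-1) 8 15 18 q
  norm_num at h h2
  rw [h2, formSeries_neg 8] at h
  exact h

/-- The integers 2 and −1 are the roots of 2 + t + 44t² modulo 5, with values 5·36 and 5·9; shears
then reduce the resulting forms. The next two lemmas follow the same pattern. -/
theorem hecke_2_1_44 {p ζ : ℂ} (hp0 : p ≠ 0) (hp : ‖p‖ < 1) (hζ : IsPrimitiveRoot ζ 5) :
    (∑ j ∈ Finset.range 5, formSeries 2 1 44 (ζ ^ j * p)) / 5 + formSeries 2 1 44 (p ^ 25)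
      = formSeries 10 7 10 (p ^ 5) + formSeries 9 3 10 (p ^ 5) := by
  have h := sum_rotate_formSeries_add hp0 hp hζ two_ne_zero formBound_2_1_44 2 (-1) 36 9
    (by norm_num) (by norm_num) (by norm_num) (by norm_num) (by norm_num) (by norm_num)
  have h1 := formSeries_shear (-2) 36 177 220 (p ^ 5)
  have h2 := formSeries_shear (-2) 10 33 36 (p ^ 5)
  have h3 := formSeries_shear 5 9 (-87) 220 (p ^ 5)
  norm_num at h h1 h2 h3
  rw [h, h1, formSeries_swap 36, h2, formSeries_neg 10 (-7), h3]
  norm_num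

theorem hecke_8_1_11 {p ζ : ℂ} (hp0 : p ≠ 0) (hp : ‖p‖ < 1) (hζ : IsPrimitiveRoot ζ 5) :
    (∑ j ∈ Finset.range 5, formSeries 8 1 11 (ζ ^ j * p)) / 5 + formSeries 8 1 11 (p ^ 25)
      = formSeries 4 1 22 (p ^ 5) + formSeries 9 3 10 (p ^ 5) := by
  have h := sum_rotate_formSeries_add hp0 hp hζ two_ne_zero formBound_8_1_11 1 3 4 22
    (by norm_num) (by norm_num) (by norm_num) (by norm_num) (by norm_num) (by norm_num)
  have h1 := formSeries_shear (-3) 4 23 55 (p ^ 5)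
  have h2 := formSeries_shear (-2) 22 67 55 (p ^ 5)
  have h3 := formSeries_shear 1 9 (-21) 22 (p ^ 5)
  norm_num at h h1 h2 h3
  rw [h, h1, formSeries_neg 4 (-1), h2, formSeries_swap 22, h3, formSeries_neg 9 (-3)]
  norm_num

theorem hecke_5_3_18 {p ζ : ℂ} (hp0 : p ≠ 0) (hp : ‖p‖ < 1) (hζ : IsPrimitiveRoot ζ 5) :
    (∑ j ∈ Finset.range 5, formSeries 5 3 18 (ζ ^ j * p)) / 5 + formSeries 5 3 18 (p ^ 25)
      = formSeries 1 1 88 (p ^ 5) + formSeries 4 1 22 (p ^ 5) := by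
  have h := sum_rotate_formSeries_add hp0 hp hζ two_ne_zero formBound_5_3_18 0 (-1) 1 4
    (by norm_num) (by norm_num) (by norm_num) (by norm_num) (by norm_num) (by norm_num)
  have h1 := formSeries_shear (-1) 1 3 90 (p ^ 5)
  have h2 := formSeries_shear 4 4 (-33) 90 (p ^ 5)
  norm_num at h h1 h2
  rw [h, h1, h2, formSeries_neg 4 (-1)]
  norm_num

/-- Apply T₅ to the identity for (2,1,44) − (8,1,11), with q = p⁵; the common image (9,3,10)
cancels. -/
theorem formSeries_4_1_22_sub {q : ℂ} (hq0 : q ≠ 0) (hq : ‖q‖ < 1) :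
    formSeries 4 1 22 q - formSeries 10 7 10 q
      = 2 * q ^ 4 * eulerE (q ^ 9) * eulerE (q ^ 39) * (rogersH (q ^ 9) * rogersG (q ^ 39)
        - q ^ 6 * rogersG (q ^ 9) * rogersH (q ^ 39)) ^ 2 := by
  obtain ⟨p, rfl⟩ := IsAlgClosed.exists_pow_nat_eq q (show 0 < 5 by norm_num)
  have hp0 : p ≠ 0 := fun h => hq0 (by rw [h, zero_pow (by norm_num)])
  have hp : ‖p‖ < 1 := by
    rw [norm_pow] at hq
    exact (pow_lt_one_iff_of_nonneg (norm_nonneg p) (by norm_num)).mp hq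
  obtain ⟨ζ, hζ⟩ : ∃ ζ : ℂ, IsPrimitiveRoot ζ 5 :=
    ⟨_, Complex.isPrimitiveRoot_exp 5 (by norm_num)⟩
  have hζ0 : ζ ≠ 0 := hζ.ne_zero (by norm_num)
  have hζn : ‖ζ‖ = 1 := hζ.norm'_eq_one (by norm_num)
  have t1 := hecke_2_1_44 hp0 hp hζ
  have t2 := hecke_8_1_11 hp0 hp hζ
  have h25 := formSeries_2_1_44_sub (pow_ne_zero 25 hp0) (norm_pow_lt_one hp (m := 25) (by norm_num))
  have hGH9 := rogersG_mul_rogersH (pow_ne_zero 9 hq0) (norm_pow_lt_one hq (m := 9) (by norm_num))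
  have hGH39 := rogersG_mul_rogersH (pow_ne_zero 39 hq0)
    (norm_pow_lt_one hq (m := 39) (by norm_num))
  have e9 : (p ^ 25) ^ 9 = ((p ^ 5) ^ 9) ^ 5 := by ring
  have e39 : (p ^ 25) ^ 39 = ((p ^ 5) ^ 39) ^ 5 := by ring
  rw [e9, e39, ← hGH9, ← hGH39] at h25
  -- Of the nine exponents in the product of the two dissections, only 20, 50 and 80 are multiples
  -- of 5 and survive the average.
  have hrot : ∑ j ∈ Finset.range 5, formSeries 2 1 44 (ζ ^ j * p)
      - ∑ j ∈ Finset.range 5, formSeries 8 1 11 (ζ ^ j * p)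
      = -(10 * (eulerE ((p ^ 5) ^ 9) * eulerE ((p ^ 5) ^ 39)) *
        (p ^ 20 * rogersH ((p ^ 5) ^ 9) ^ 2 * rogersG ((p ^ 5) ^ 39) ^ 2
          - p ^ 50 * (rogersG ((p ^ 5) ^ 9) * rogersH ((p ^ 5) ^ 9) * rogersG ((p ^ 5) ^ 39)
            * rogersH ((p ^ 5) ^ 39))
          + p ^ 80 * rogersG ((p ^ 5) ^ 9) ^ 2 * rogersH ((p ^ 5) ^ 39) ^ 2)) := by
    rw [← Finset.sum_sub_distrib]
    generalize hE9 : eulerE ((p ^ 5) ^ 9) = E₁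
    generalize hE39 : eulerE ((p ^ 5) ^ 39) = E₂
    generalize hG9 : rogersG ((p ^ 5) ^ 9) = G₁
    generalize hG39 : rogersG ((p ^ 5) ^ 39) = G₂
    generalize hH9 : rogersH ((p ^ 5) ^ 9) = H₁
    generalize hH39 : rogersH ((p ^ 5) ^ 39) = H₂
    have hterm : ∀ j ∈ Finset.range 5,
        formSeries 2 1 44 (ζ ^ j * p) - formSeries 8 1 11 (ζ ^ j * p)
        = 2 * E₁ * E₂ * (G₁ ^ 2 * G₂ ^ 2 * (ζ ^ j * p) ^ 2
          - G₁ * H₁ * G₂ ^ 2 * (ζ ^ j * p) ^ 11 - H₁ ^ 2 * G₂ ^ 2 * (ζ ^ j * p) ^ 20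
          - G₁ ^ 2 * G₂ * H₂ * (ζ ^ j * p) ^ 41 + G₁ * H₁ * G₂ * H₂ * (ζ ^ j * p) ^ 50
          + H₁ ^ 2 * G₂ * H₂ * (ζ ^ j * p) ^ 59 - G₁ ^ 2 * H₂ ^ 2 * (ζ ^ j * p) ^ 80
          + G₁ * H₁ * H₂ ^ 2 * (ζ ^ j * p) ^ 89 + H₁ ^ 2 * H₂ ^ 2 * (ζ ^ j * p) ^ 98) := by
      intro j _
      rw [formSeries_2_1_44_sub (mul_ne_zero (pow_ne_zero j hζ0) hp0) (by simpa [hζn] using hp),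
        eulerE_rotate_pow hp0 hp hζ j (by norm_num), eulerE_rotate_pow hp0 hp hζ j (by norm_num),
        hE9, hE39, hG9, hG39, hH9, hH39]
      generalize ζ ^ j * p = x
      ring
    rw [Finset.sum_congr rfl hterm, ← Finset.mul_sum]
    simp only [Finset.sum_add_distrib, Finset.sum_sub_distrib, ← Finset.mul_sum,
      sum_rotate_pow hζ]
    norm_num
    ring
  -- The middle term at p⁵⁰ occurs once in the average and once in the series at p²⁵, which makes
  -- the total a perfect square.
  linear_combination t1 - t2 - (1 / 5 : ℂ) * hrot - h25

/-- The same argument from (5,3,18) − (8,1,11): now (4,1,22) cancels and the surviving exponents are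
5, 125 and 245. -/
theorem formSeries_1_1_88_sub {q : ℂ} (hq0 : q ≠ 0) (hq : ‖q‖ < 1) :
    formSeries 1 1 88 q - formSeries 9 3 10 q
      = 2 * q * eulerE (q ^ 3) * eulerE (q ^ 117) * (rogersG (q ^ 3) * rogersG (q ^ 117)
        + q ^ 24 * rogersH (q ^ 3) * rogersH (q ^ 117)) ^ 2 := by
  obtain ⟨p, rfl⟩ := IsAlgClosed.exists_pow_nat_eq q (show 0 < 5 by norm_num)
  have hp0 : p ≠ 0 := fun h => hq0 (by rw [h, zero_pow (by norm_num)])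
  have hp : ‖p‖ < 1 := by
    rw [norm_pow] at hq
    exact (pow_lt_one_iff_of_nonneg (norm_nonneg p) (by norm_num)).mp hq
  obtain ⟨ζ, hζ⟩ : ∃ ζ : ℂ, IsPrimitiveRoot ζ 5 :=
    ⟨_, Complex.isPrimitiveRoot_exp 5 (by norm_num)⟩
  have hζ0 : ζ ≠ 0 := hζ.ne_zero (by norm_num)
  have hζn : ‖ζ‖ = 1 := hζ.norm'_eq_one (by norm_num)
  have t1 := hecke_5_3_18 hp0 hp hζ
  have t2 := hecke_8_1_11 hp0 hp hζ
  have h25 := formSeries_5_3_18_sub (pow_ne_zero 25 hp0) (norm_pow_lt_one hp (m := 25) (by norm_num))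
  have hGH3 := rogersG_mul_rogersH (pow_ne_zero 3 hq0) (norm_pow_lt_one hq (m := 3) (by norm_num))
  have hGH117 := rogersG_mul_rogersH (pow_ne_zero 117 hq0)
    (norm_pow_lt_one hq (m := 117) (by norm_num))
  have e3 : (p ^ 25) ^ 3 = ((p ^ 5) ^ 3) ^ 5 := by ring
  have e117 : (p ^ 25) ^ 117 = ((p ^ 5) ^ 117) ^ 5 := by ring
  rw [e3, e117, ← hGH3, ← hGH117] at h25
  have hrot : ∑ j ∈ Finset.range 5, formSeries 5 3 18 (ζ ^ j * p)
      - ∑ j ∈ Finset.range 5, formSeries 8 1 11 (ζ ^ j * p)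
      = 10 * (eulerE ((p ^ 5) ^ 3) * eulerE ((p ^ 5) ^ 117)) *
        (p ^ 5 * rogersG ((p ^ 5) ^ 3) ^ 2 * rogersG ((p ^ 5) ^ 117) ^ 2
          + p ^ 125 * (rogersG ((p ^ 5) ^ 3) * rogersH ((p ^ 5) ^ 3) * rogersG ((p ^ 5) ^ 117)
            * rogersH ((p ^ 5) ^ 117))
          + p ^ 245 * rogersH ((p ^ 5) ^ 3) ^ 2 * rogersH ((p ^ 5) ^ 117) ^ 2) := by
    rw [← Finset.sum_sub_distrib]
    generalize hE3 : eulerE ((p ^ 5) ^ 3) = E₁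
    generalize hE117 : eulerE ((p ^ 5) ^ 117) = E₂
    generalize hG3 : rogersG ((p ^ 5) ^ 3) = G₁
    generalize hG117 : rogersG ((p ^ 5) ^ 117) = G₂
    generalize hH3 : rogersH ((p ^ 5) ^ 3) = H₁
    generalize hH117 : rogersH ((p ^ 5) ^ 117) = H₂
    have hterm : ∀ j ∈ Finset.range 5,
        formSeries 5 3 18 (ζ ^ j * p) - formSeries 8 1 11 (ζ ^ j * p)
        = 2 * E₁ * E₂ * (G₁ ^ 2 * G₂ ^ 2 * (ζ ^ j * p) ^ 5
          - G₁ * H₁ * G₂ ^ 2 * (ζ ^ j * p) ^ 8 - H₁ ^ 2 * G₂ ^ 2 * (ζ ^ j * p) ^ 11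
          - G₁ ^ 2 * G₂ * H₂ * (ζ ^ j * p) ^ 122 + G₁ * H₁ * G₂ * H₂ * (ζ ^ j * p) ^ 125
          + H₁ ^ 2 * G₂ * H₂ * (ζ ^ j * p) ^ 128 - G₁ ^ 2 * H₂ ^ 2 * (ζ ^ j * p) ^ 239
          + G₁ * H₁ * H₂ ^ 2 * (ζ ^ j * p) ^ 242 + H₁ ^ 2 * H₂ ^ 2 * (ζ ^ j * p) ^ 245) := by
      intro j _
      rw [formSeries_5_3_18_sub (mul_ne_zero (pow_ne_zero j hζ0) hp0) (by simpa [hζn] using hp),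
        eulerE_rotate_pow hp0 hp hζ j (by norm_num), eulerE_rotate_pow hp0 hp hζ j (by norm_num),
        hE3, hE117, hG3, hG117, hH3, hH117]
      generalize ζ ^ j * p = x
      ring
    rw [Finset.sum_congr rfl hterm, ← Finset.mul_sum]
    simp only [Finset.sum_add_distrib, Finset.sum_sub_distrib, ← Finset.mul_sum,
      sum_rotate_pow hζ]
    norm_num
    ring
  linear_combination t2 - t1 + (1 / 5 : ℂ) * hrot + h25

/-! ### Discriminant −39: one difference of form series, two Rogers–Ramanujan expressions -/

theorem summable_jacobiSeries_five {p : ℂ} (hp0 : p ≠ 0) (hp : ‖p‖ < 1) {A i : ℕ} (hA : A ≠ 0) :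
    Summable (fun n : ℤ => ‖(-1 : ℂ) ^ n * p ^ (A * (5 * (((5 - i) / 2 : ℕ) * n
      + 5 * (n * (n - 1) / 2))))‖) ∧
    jacobiSeries (((p ^ 5) ^ A) ^ ((5 - i) / 2)) (((p ^ 5) ^ A) ^ 5)
      = ∑' n : ℤ, (-1 : ℂ) ^ n * p ^ (A * (5 * (((5 - i) / 2 : ℕ) * n + 5 * (n * (n - 1) / 2)))) := by
  have hq0 := pow_ne_zero A (pow_ne_zero 5 hp0)
  have hterm : ∀ n : ℤ, (-((p ^ 5) ^ A) ^ ((5 - i) / 2)) ^ n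
      * (((p ^ 5) ^ A) ^ 5) ^ (n * (n - 1) / 2)
      = (-1 : ℂ) ^ n * p ^ (A * (5 * (((5 - i) / 2 : ℕ) * n + 5 * (n * (n - 1) / 2)))) := fun n => by
    have hQ : ∀ m : ℤ, ((p ^ 5) ^ A) ^ m = p ^ (A * (5 * m)) := fun m => by
      rw [← pow_mul, ← zpow_natCast, ← zpow_mul]
      congr 1
      push_cast
      ring
    rw [← hQ, neg_eq_neg_one_mul, mul_zpow, mul_assoc, zpow_add₀ hq0, zpow_mul, zpow_mul]
    norm_cast
  refine ⟨((summable_zpow_mul_zpow (pow_ne_zero 5 hq0) (norm_pow_lt_one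
    (norm_pow_lt_one (norm_pow_lt_one hp (by norm_num)) hA) (by norm_num)) _).congr hterm).norm, ?_⟩
  exact tsum_congr hterm

/-- The analogue modulo 10 of the Euler product computation: n = 10b−j, n+4t = ±(10a−i), again with
8N = A(n+4t)² + Bn². The constant part (Ai²+Bj²)/8 is d. The index 1 leads to the theta series of G
and the index 3 to that of H. -/
theorem tsum_residue_eq_jacobiSeries_mul {p : ℂ} (hp0 : p ≠ 0) (hp : ‖p‖ < 1) {A B c i j d : ℕ}
    (hA : A ≠ 0) (hB : B ≠ 0) (hAB : A + B = 8 * c) (hi : i = 1 ∨ i = 3) (hj : j = 1 ∨ j = 3)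
    (hd : A * i ^ 2 + B * j ^ 2 = 8 * d) {w : ℤ × ℤ → ℂ} {δ : ℂ}
    (hsupp : ∀ n t : ℤ, n % 10 = 10 - j → w (n, t) ≠ 0 →
      (10 : ℤ) ∣ n + 4 * t - i ∨ (10 : ℤ) ∣ n + 4 * t + i)
    (hval : ∀ a b t : ℤ, 10 * b - j + 4 * t = 10 * a - i ∨ 10 * b - j + 4 * t = -(10 * a - i) →
      w (10 * b - j, t) = δ * (-1) ^ (a + b)) :
    ∑' v : ℤ × ℤ, (if v.1 % 10 = 10 - j then
        w v * p ^ (c * v.1 ^ 2 + A * v.1 * v.2 + 2 * A * v.2 ^ 2) else 0)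
      = δ * p ^ d * jacobiSeries (((p ^ 5) ^ A) ^ ((5 - i) / 2)) (((p ^ 5) ^ A) ^ 5)
        * jacobiSeries (((p ^ 5) ^ B) ^ ((5 - j) / 2)) (((p ^ 5) ^ B) ^ 5) := by
  obtain ⟨sA, eA⟩ := summable_jacobiSeries_five (i := i) hp0 hp hA
  obtain ⟨sB, eB⟩ := summable_jacobiSeries_five (i := j) hp0 hp hB
  set N : ℤ × ℤ → ℤ := fun v => c * v.1 ^ 2 + A * v.1 * v.2 + 2 * A * v.2 ^ 2 with hNdef
  -- Since i and j are odd, exactly one of ±(10a−i) is congruent to n modulo 4; this choice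
  -- determines t.
  rw [tsum_ite_eq_tsum_comp (F := fun v => w v * p ^ N v) (e := fun x : ℤ × ℤ => (10 * x.2 - j,
    if (4 : ℤ) ∣ 10 * x.1 - i - (10 * x.2 - j) then (10 * x.1 - i - (10 * x.2 - j)) / 4
      else (-(10 * x.1 - i) - (10 * x.2 - j)) / 4)), mul_assoc,
    eA, eB, tsum_mul_tsum_of_summable_norm sA sB, ← tsum_mul_left]
  · refine tsum_congr fun x => ?_
    obtain ⟨a, b⟩ := x
    have hm1 : (-1 : ℂ) ≠ 0 := by norm_num
    have key : ∀ t : ℤ, 10 * b - j + 4 * t = 10 * a - i ∨ 10 * b - j + 4 * t = -(10 * a - i) →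
        w (10 * b - j, t) * p ^ N (10 * b - j, t)
        = δ * p ^ d * ((-1) ^ a * p ^ (A * (5 * (((5 - i) / 2 : ℕ) * a + 5 * (a * (a - 1) / 2))))
          * ((-1) ^ b * p ^ (B * (5 * (((5 - j) / 2 : ℕ) * b + 5 * (b * (b - 1) / 2)))))) := by
      intro t ht
      have hsq : (10 * b - j + 4 * t) ^ 2 = (10 * a - i) ^ 2 := by
        rcases ht with h | h <;> rw [h]
        ring
      have hexp : N (10 * b - j, t) = d
          + (A * (5 * (((5 - i) / 2 : ℕ) * a + 5 * (a * (a - 1) / 2)))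
            + B * (5 * (((5 - j) / 2 : ℕ) * b + 5 * (b * (b - 1) / 2)))) := by
        have h1 := two_mul_ediv_mul_sub_one a
        have h2 := two_mul_ediv_mul_sub_one b
        have h3 : (A : ℤ) + B = 8 * c := by exact_mod_cast hAB
        have h5 : (A : ℤ) * i ^ 2 + B * j ^ 2 = 8 * d := by exact_mod_cast hd
        have h6 : 2 * (((5 - i) / 2 : ℕ) : ℤ) = 5 - i := by omega
        have h7 : 2 * (((5 - j) / 2 : ℕ) : ℤ) = 5 - j := by omega
        have h4 : 8 * N (10 * b - j, t) = 8 * (d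
          + (A * (5 * (((5 - i) / 2 : ℕ) * a + 5 * (a * (a - 1) / 2)))
            + B * (5 * (((5 - j) / 2 : ℕ) * b + 5 * (b * (b - 1) / 2))))) := by
          simp only [hNdef]
          linear_combination (A : ℤ) * hsq - 100 * A * h1 - 100 * B * h2
            - (10 * b - j : ℤ) ^ 2 * h3 + h5 - 20 * A * a * h6 - 20 * B * b * h7
        linarith
      rw [hexp, hval a b t ht, zpow_add₀ hp0, zpow_add₀ hp0, zpow_add₀ hm1, zpow_natCast]
      ring
    simp only
    split_ifs with h
    · exact key _ (Or.inl (by omega))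
    · refine key _ (Or.inr ?_)
      rcases hi with rfl | rfl <;> rcases hj with rfl | rfl <;> push_cast at h ⊢ <;> omega
  · rintro ⟨x, y⟩ ⟨x', y'⟩ h
    simp only [Prod.mk.injEq] at h ⊢
    obtain ⟨h1, h2⟩ := h
    rcases hi with rfl | rfl <;> rcases hj with rfl | rfl <;> push_cast at h1 h2 <;>
      split_ifs at h2 <;> omega
  · rintro ⟨n, t⟩ h hne
    simp only at h hne
    have hd := hsupp n t h (left_ne_zero_of_mul hne)
    by_cases h3 : (10 : ℤ) ∣ n + 4 * t + i
    · refine ⟨((n + 4 * t + i) / 10, (n + j) / 10), ?_⟩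
      simp only [Prod.mk.injEq]
      rw [if_pos (by omega)]
      omega
    · have h4 := hd.resolve_right h3
      refine ⟨((i - (n + 4 * t)) / 10, (n + j) / 10), ?_⟩
      simp only [Prod.mk.injEq]
      rw [if_neg (by
        rcases hi with rfl | rfl <;> rcases hj with rfl | rfl <;> push_cast at h h3 h4 ⊢ <;> omega)]
      omega
  · intro x
    simp only
    rcases hj with rfl | rfl <;> push_cast <;> omega

/-- Difference of the generating functions of the two sublattices `t ≡ r n (mod 5)`, `r = r₁, r₂`,
as a sum over two residue classes modulo `10`. -/
theorem formSeries_sub_eq_tsum_residues {p : ℂ} (hp0 : p ≠ 0) (hp : ‖p‖ < 1) {A c K : ℕ}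
    (hK : K ≠ 0)
    (hN : ∀ v : ℤ × ℤ, v.1 ^ 2 + v.2 ^ 2 ≤ K * (c * v.1 ^ 2 + A * v.1 * v.2 + 2 * A * v.2 ^ 2))
    {r₁ r₂ a₁ a₂ : ℤ} (h₁ : c + A * r₁ + 2 * A * r₁ ^ 2 = 5 * a₁)
    (h₂ : c + A * r₂ + 2 * A * r₂ ^ 2 = 5 * a₂) (hr : (5 : ℤ) ∣ r₁ + r₂ - 2) :
    formSeries a₁ (A + 4 * A * r₁) (10 * A) (p ^ 5) - formSeries a₂ (A + 4 * A * r₂) (10 * A) (p ^ 5)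
      = 2 * (∑' v : ℤ × ℤ, (if v.1 % 10 = 10 - (1 : ℕ) then
          ((if 5 ∣ v.2 - r₁ * v.1 then 1 else 0) - (if 5 ∣ v.2 - r₂ * v.1 then 1 else 0))
          * p ^ (c * v.1 ^ 2 + A * v.1 * v.2 + 2 * A * v.2 ^ 2) else 0)
        + ∑' v : ℤ × ℤ, (if v.1 % 10 = 10 - (3 : ℕ) then
          ((if 5 ∣ v.2 - r₁ * v.1 then 1 else 0) - (if 5 ∣ v.2 - r₂ * v.1 then 1 else 0))
          * p ^ (c * v.1 ^ 2 + A * v.1 * v.2 + 2 * A * v.2 ^ 2) else 0)) := by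
  set N : ℤ × ℤ → ℤ := fun v => c * v.1 ^ 2 + A * v.1 * v.2 + 2 * A * v.2 ^ 2 with hNdef
  have hs : Summable fun v => p ^ N v := summable_zpow_of_sq_add_sq_le hp0 hp hK hN
  have hsi : ∀ P : ℤ × ℤ → Prop, ∀ [DecidablePred P],
      Summable fun v => if P v then p ^ N v else 0 := fun P _ => by
    refine (hs.indicator {v | P v}).congr fun v => ?_
    simp [Set.indicator_apply]
  set F : ℤ × ℤ → ℂ := fun v => ((if 5 ∣ v.2 - r₁ * v.1 then 1 else 0)
    - (if 5 ∣ v.2 - r₂ * v.1 then 1 else 0)) * p ^ N v with hF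
  have hF' : ∀ v, F v = (if 5 ∣ v.2 - r₁ * v.1 then p ^ N v else 0)
      - (if 5 ∣ v.2 - r₂ * v.1 then p ^ N v else 0) := fun v => by
    simp only [hF, sub_mul, ite_mul, one_mul, zero_mul]
  have hFs : Summable F := by
    simp only [funext hF']
    exact (hsi _).sub (hsi _)
  have hFi : ∀ P : ℤ × ℤ → Prop, ∀ [DecidablePred P],
      Summable fun v => if P v then F v else 0 := fun P _ => by
    refine (hFs.indicator {v | P v}).congr fun v => ?_
    simp [Set.indicator_apply]
  have hline : ∀ r a' : ℤ, c + A * r + 2 * A * r ^ 2 = 5 * a' →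
      ∑' v : ℤ × ℤ, (if 5 ∣ v.2 - r * v.1 then p ^ N v else 0)
        = formSeries a' (A + 4 * A * r) (10 * A) (p ^ 5) := fun r a' h => by
    rw [tsum_ite_eq_tsum_comp (e := fun x : ℤ × ℤ => (x.1, r * x.1 + 5 * x.2))]
    · refine tsum_congr fun x => ?_
      rw [← zpow_natCast, ← zpow_mul]
      congr 1
      simp only [hNdef]
      push_cast
      linear_combination x.1 ^ 2 * h
    · rintro ⟨x, y⟩ ⟨x', y'⟩ h
      simp only [Prod.mk.injEq] at h ⊢
      obtain ⟨rfl, h⟩ := h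
      exact ⟨rfl, by omega⟩
    · rintro ⟨n, m⟩ ⟨k, hk⟩ -
      exact ⟨(n, k), by simp only [Prod.mk.injEq, true_and]; linarith⟩
    · intro x
      exact ⟨x.2, by ring⟩
  -- The same reflection as for 3; here it exchanges the sublattices because r₁ + r₂ ≡ 2 (mod 5).
  have heven : ∑' v : ℤ × ℤ, (if v.1 % 2 = 0 then F v else 0) = 0 := by
    rw [tsum_ite_eq_tsum_comp (e := fun x : ℤ × ℤ => (2 * x.1, x.2))]
    · set φ : ℤ × ℤ ≃ ℤ × ℤ :=
        { toFun := fun x => (-x.1, x.2 + x.1)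
          invFun := fun x => (-x.1, x.2 + x.1)
          left_inv := fun x => by simp
          right_inv := fun x => by simp } with hφ
      have h : ∑' x : ℤ × ℤ, F (2 * x.1, x.2) = -∑' x : ℤ × ℤ, F (2 * x.1, x.2) := by
        conv_lhs => rw [← φ.tsum_eq]
        rw [← tsum_neg]
        refine tsum_congr fun x => ?_
        have hN1 : N (2 * (φ x).1, (φ x).2) = N (2 * x.1, x.2) := by
          simp only [hNdef, hφ, Equiv.coe_fn_mk]; ring
        obtain ⟨m, hm⟩ := hr
        have d1 : (5 : ℤ) ∣ (φ x).2 - r₁ * (2 * (φ x).1) ↔ 5 ∣ x.2 - r₂ * (2 * x.1) := by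
          rw [show (φ x).2 - r₁ * (2 * (φ x).1) = x.2 - r₂ * (2 * x.1) + 5 * ((2 * m + 1) * x.1) by
            simp only [hφ, Equiv.coe_fn_mk]; linear_combination (2 * x.1) * hm]
          exact dvd_add_left ⟨_, rfl⟩
        have d2 : (5 : ℤ) ∣ (φ x).2 - r₂ * (2 * (φ x).1) ↔ 5 ∣ x.2 - r₁ * (2 * x.1) := by
          rw [show (φ x).2 - r₂ * (2 * (φ x).1) = x.2 - r₁ * (2 * x.1) + 5 * ((2 * m + 1) * x.1) by
            simp only [hφ, Equiv.coe_fn_mk]; linear_combination (2 * x.1) * hm]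
          exact dvd_add_left ⟨_, rfl⟩
        simp only [hF, hN1, d1, d2]
        ring
      exact self_eq_neg.mp h
    · rintro ⟨x, y⟩ ⟨x', y'⟩ h
      simp only [Prod.mk.injEq] at h ⊢
      omega
    · rintro ⟨n, m⟩ h -
      simp only at h
      exact ⟨(n / 2, m), by simp only [Prod.mk.injEq, and_true]; omega⟩
    · intro x
      simp only
      omega
  have hneg : ∀ j : ℤ, 0 < j → j < 10 → ∑' v : ℤ × ℤ, (if v.1 % 10 = j then F v else 0)
      = ∑' v : ℤ × ℤ, (if v.1 % 10 = 10 - j then F v else 0) := fun j hj0 hj => by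
    rw [← (Equiv.neg (ℤ × ℤ)).tsum_eq]
    refine tsum_congr fun v => ?_
    have hN1 : N (-v) = N v := by simp only [hNdef, Prod.fst_neg, Prod.snd_neg]; ring
    have d0 : (-v).1 % 10 = j ↔ v.1 % 10 = 10 - j := by simp only [Prod.fst_neg]; omega
    have d : ∀ r : ℤ, (5 : ℤ) ∣ (-v).2 - r * (-v).1 ↔ 5 ∣ v.2 - r * v.1 := fun r => by
      rw [show (-v).2 - r * (-v).1 = -(v.2 - r * v.1) by
        simp only [Prod.fst_neg, Prod.snd_neg]; ring, dvd_neg]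
    simp only [Equiv.neg_apply, hF, hN1, d0, d]
  have hsplit : ∑' v, F v = ∑' v : ℤ × ℤ, (if v.1 % 2 = 0 then F v else 0)
      + ∑' v : ℤ × ℤ, (if v.1 % 10 = 1 then F v else 0)
      + ∑' v : ℤ × ℤ, (if v.1 % 10 = 10 - 1 then F v else 0)
      + ∑' v : ℤ × ℤ, (if v.1 % 10 = 3 then F v else 0)
      + ∑' v : ℤ × ℤ, (if v.1 % 10 = 10 - 3 then F v else 0) := by
    have s1 := (hFi fun v => v.1 % 2 = 0).add (hFi fun v => v.1 % 10 = 1)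
    have s2 := s1.add (hFi fun v => v.1 % 10 = 10 - 1)
    have s3 := s2.add (hFi fun v => v.1 % 10 = 3)
    rw [← (hFi _).tsum_add (hFi _), ← s1.tsum_add (hFi _), ← s2.tsum_add (hFi _),
      ← s3.tsum_add (hFi _)]
    refine tsum_congr fun v => ?_
    by_cases c2 : v.1 % 2 = 0
    · simp [c2, show ¬ v.1 % 10 = 1 by omega, show ¬ v.1 % 10 = 9 by omega,
        show ¬ v.1 % 10 = 3 by omega, show ¬ v.1 % 10 = 7 by omega]
    by_cases c5 : v.1 % 10 = 5
    · have hz : F v = 0 := by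
        -- On n ≡ 5 (mod 10) both conditions say 5 ∣ t, so F vanishes.
        have h5 : (5 : ℤ) ∣ v.1 := by omega
        have d : ∀ r : ℤ, (5 : ℤ) ∣ v.2 - r * v.1 ↔ 5 ∣ v.2 := fun r =>
          dvd_sub_left (h5.mul_left r)
        simp only [hF, d, sub_self, zero_mul]
      simp [hz]
    rcases (by omega : v.1 % 10 = 1 ∨ v.1 % 10 = 9 ∨ v.1 % 10 = 3 ∨ v.1 % 10 = 7) with
      h | h | h | h <;> simp [h, c2]
  have hD : formSeries a₁ (A + 4 * A * r₁) (10 * A) (p ^ 5)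
      - formSeries a₂ (A + 4 * A * r₂) (10 * A) (p ^ 5) = ∑' v, F v := by
    rw [← hline r₁ a₁ h₁, ← hline r₂ a₂ h₂, ← (hsi _).tsum_sub (hsi _)]
    exact tsum_congr fun v => (hF' v).symm
  rw [hD, hsplit, heven, hneg 1 (by norm_num) (by norm_num), hneg 3 (by norm_num) (by norm_num)]
  push_cast
  ring

theorem rogersG_mul_eulerE_eq_jacobiSeries {q : ℂ} (hq0 : q ≠ 0) (hq : ‖q‖ < 1) :
    jacobiSeries (q ^ 2) (q ^ 5) = rogersG q * eulerE q := by
  rw [eulerE_eq_qShiftedFactorialInf hq0 hq, rogersG_mul_qShiftedFactorialInf hq0 hq]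

theorem rogersH_mul_eulerE_eq_jacobiSeries {q : ℂ} (hq0 : q ≠ 0) (hq : ‖q‖ < 1) :
    jacobiSeries q (q ^ 5) = rogersH q * eulerE q := by
  rw [eulerE_eq_qShiftedFactorialInf hq0 hq, rogersH_mul_qShiftedFactorialInf hq0 hq,
    ← jacobiSeries_symm (pow_ne_zero 5 hq0) (pow_ne_zero 4 hq0)]
  congr 1
  field_simp

theorem ite_sub_ite_eq_of_parity {P P' : Prop} [Decidable P] [Decidable P'] {m : ℤ}
    (h : m % 2 = 0 → P ∧ ¬ P') (h' : m % 2 = 1 → ¬ P ∧ P') :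
    ((if P then 1 else 0) - (if P' then 1 else 0) : ℂ) = (-1) ^ m := by
  rcases Int.emod_two_eq_zero_or_one m with hm | hm
  · rw [(Int.even_iff.mpr hm).neg_one_zpow, if_pos (h hm).1, if_neg (h hm).2, sub_zero]
  · rw [(Int.odd_iff.mpr hm).neg_one_zpow, if_neg (h' hm).1, if_pos (h' hm).2, zero_sub]

theorem or_of_ite_sub_ite_ne_zero {P P' : Prop} [Decidable P] [Decidable P']
    (h : ((if P then 1 else 0) - (if P' then 1 else 0) : ℂ) ≠ 0) : P ∨ P' := by
  by_contra hcon
  push Not at hcon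
  exact h (by rw [if_neg hcon.1, if_neg hcon.2, sub_zero])

/-- On t ≡ 0 and t ≡ 2n (mod 5) one has n + 4t ≡ ±n, hence i = j: the two residue classes give GG
and HH. -/
theorem formSeries_1_1_10_sub_eq_rogers_1_39 {q : ℂ} (hq0 : q ≠ 0) (hq : ‖q‖ < 1) :
    formSeries 1 1 10 q - formSeries 3 3 4 q = 2 * q * eulerE q * eulerE (q ^ 39)
      * (rogersG q * rogersG (q ^ 39) + q ^ 8 * rogersH q * rogersH (q ^ 39)) := by
  obtain ⟨p, rfl⟩ := IsAlgClosed.exists_pow_nat_eq q (show 0 < 5 by norm_num)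
  have hp0 : p ≠ 0 := fun h => hq0 (by rw [h, zero_pow (by norm_num)])
  have hp : ‖p‖ < 1 := by
    rw [norm_pow] at hq
    exact (pow_lt_one_iff_of_nonneg (norm_nonneg p) (by norm_num)).mp hq
  have h := formSeries_sub_eq_tsum_residues hp0 hp (A := 1) (c := 5) (K := 2) (r₁ := 0)
    (r₂ := 2) (a₁ := 1) (a₂ := 3) (by norm_num) (fun v => by
      push_cast; nlinarith [sq_nonneg (v.1 + v.2), sq_nonneg v.2, sq_nonneg v.1])
    (by norm_num) (by norm_num) (by norm_num)
  rw [tsum_residue_eq_jacobiSeries_mul hp0 hp (A := 1) (B := 39) (c := 5) (i := 1) (j := 1) (d := 5)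
      (δ := 1) (by norm_num) (by norm_num) (by norm_num) (by norm_num) (by norm_num) (by norm_num)
      (w := fun v => (if 5 ∣ v.2 - 0 * v.1 then 1 else 0) - (if 5 ∣ v.2 - 2 * v.1 then 1 else 0)),
    tsum_residue_eq_jacobiSeries_mul hp0 hp (A := 1) (B := 39) (c := 5) (i := 3) (j := 3) (d := 45)
      (δ := 1) (by norm_num) (by norm_num) (by norm_num) (by norm_num) (by norm_num) (by norm_num)
      (w := fun v => (if 5 ∣ v.2 - 0 * v.1 then 1 else 0) - (if 5 ∣ v.2 - 2 * v.1 then 1 else 0))]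
    at h
  · have hq39 := norm_pow_lt_one hq (m := 39) (by norm_num)
    have hs := formSeries_shear (-1) 3 9 10 (p ^ 5)
    norm_num only [Nat.reduceSub, Nat.reduceDiv, Nat.cast_one, pow_one] at h hs
    rw [hs, rogersG_mul_eulerE_eq_jacobiSeries hq0 hq,
      rogersG_mul_eulerE_eq_jacobiSeries (pow_ne_zero 39 hq0) hq39,
      rogersH_mul_eulerE_eq_jacobiSeries hq0 hq,
      rogersH_mul_eulerE_eq_jacobiSeries (pow_ne_zero 39 hq0) hq39] at h
    rw [h]
    ring
  · intro n t hn hw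
    have := or_of_ite_sub_ite_ne_zero hw
    omega
  · intro a b t ht
    rw [one_mul]
    exact ite_sub_ite_eq_of_parity (by omega) (by omega)
  · intro n t hn hw
    have := or_of_ite_sub_ite_ne_zero hw
    omega
  · intro a b t ht
    rw [one_mul]
    exact ite_sub_ite_eq_of_parity (by omega) (by omega)

/-- On t ≡ −n and t ≡ 3n (mod 5) one has n + 4t ≡ ±3n, so i and j are 1 and 3 in some order: the
classes give HG and GH, the latter with δ = −1. -/
theorem formSeries_1_1_10_sub_eq_rogers_3_13 {q : ℂ} (hq0 : q ≠ 0) (hq : ‖q‖ < 1) :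
    formSeries 1 1 10 q - formSeries 3 3 4 q = 2 * q * eulerE (q ^ 3) * eulerE (q ^ 13)
      * (rogersH (q ^ 3) * rogersG (q ^ 13) - q ^ 2 * rogersG (q ^ 3) * rogersH (q ^ 13)) := by
  obtain ⟨p, rfl⟩ := IsAlgClosed.exists_pow_nat_eq q (show 0 < 5 by norm_num)
  have hp0 : p ≠ 0 := fun h => hq0 (by rw [h, zero_pow (by norm_num)])
  have hp : ‖p‖ < 1 := by
    rw [norm_pow] at hq
    exact (pow_lt_one_iff_of_nonneg (norm_nonneg p) (by norm_num)).mp hq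
  have h := formSeries_sub_eq_tsum_residues hp0 hp (A := 3) (c := 2) (K := 2) (r₁ := (-1))
    (r₂ := 3) (a₁ := 1) (a₂ := 13) (by norm_num) (fun v => by
      push_cast; nlinarith [sq_nonneg (v.1 + v.2), sq_nonneg v.2, sq_nonneg v.1])
    (by norm_num) (by norm_num) (by norm_num)
  rw [tsum_residue_eq_jacobiSeries_mul hp0 hp (A := 3) (B := 13) (c := 2) (i := 3) (j := 1) (d := 5)
      (δ := 1) (by norm_num) (by norm_num) (by norm_num) (by norm_num) (by norm_num) (by norm_num)
      (w := fun v => (if 5 ∣ v.2 - (-1) * v.1 then 1 else 0) - (if 5 ∣ v.2 - 3 * v.1 then 1 else 0)),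
    tsum_residue_eq_jacobiSeries_mul hp0 hp (A := 3) (B := 13) (c := 2) (i := 1) (j := 3) (d := 15)
      (δ := (-1)) (by norm_num) (by norm_num) (by norm_num) (by norm_num) (by norm_num) (by norm_num)
      (w := fun v => (if 5 ∣ v.2 - (-1) * v.1 then 1 else 0) - (if 5 ∣ v.2 - 3 * v.1 then 1 else 0))]
    at h
  · have hq3 := norm_pow_lt_one hq (m := 3) (by norm_num)
    have hq13 := norm_pow_lt_one hq (m := 13) (by norm_num)
    have hs1 := formSeries_shear 4 1 (-9) 30 (p ^ 5)
    have hs2 := formSeries_shear (-1) 13 39 30 (p ^ 5)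
    have hs3 := formSeries_shear (-2) 4 13 13 (p ^ 5)
    norm_num only [Nat.reduceSub, Nat.reduceDiv, Nat.cast_one, pow_one] at h hs1 hs2 hs3
    rw [hs1, hs2, formSeries_neg 1 (-1), formSeries_swap 13, hs3, formSeries_neg 4 (-3),
      formSeries_swap 4, neg_neg, neg_neg,
      rogersG_mul_eulerE_eq_jacobiSeries (pow_ne_zero 3 hq0) hq3,
      rogersG_mul_eulerE_eq_jacobiSeries (pow_ne_zero 13 hq0) hq13,
      rogersH_mul_eulerE_eq_jacobiSeries (pow_ne_zero 3 hq0) hq3,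
      rogersH_mul_eulerE_eq_jacobiSeries (pow_ne_zero 13 hq0) hq13] at h
    rw [h]
    ring
  · intro n t hn hw
    have := or_of_ite_sub_ite_ne_zero hw
    omega
  · intro a b t ht
    have hs : (-1 : ℂ) * (-1) ^ (a + b) = (-1) ^ (a + b + 1) := by
      rw [zpow_add_one₀ (by norm_num)]; ring
    rw [hs]
    exact ite_sub_ite_eq_of_parity (by omega) (by omega)
  · intro n t hn hw
    have := or_of_ite_sub_ite_ne_zero hw
    omega
  · intro a b t ht
    rw [one_mul]
    exact ite_sub_ite_eq_of_parity (by omega) (by omega)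

/-! ### Analyticity and the zeros of the denominator -/

/-- The exponents are nonnegative, so each term is entire; on ‖w‖ < r the series is dominated by its
value at the real point r < 1. -/
theorem analyticOnNhd_formSeries {a b c : ℤ} {K : ℕ} (hK : K ≠ 0)
    (hN : ∀ v : ℤ × ℤ, v.1 ^ 2 + v.2 ^ 2 ≤ K * (a * v.1 ^ 2 + b * v.1 * v.2 + c * v.2 ^ 2)) :
    AnalyticOnNhd ℂ (formSeries a b c) (Metric.ball 0 1) := by
  have hN0 : ∀ v : ℤ × ℤ, 0 ≤ a * v.1 ^ 2 + b * v.1 * v.2 + c * v.2 ^ 2 := fun v => by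
    have h1 : 0 ≤ (K : ℤ) * (a * v.1 ^ 2 + b * v.1 * v.2 + c * v.2 ^ 2) :=
      (by positivity : (0 : ℤ) ≤ v.1 ^ 2 + v.2 ^ 2).trans (hN v)
    exact nonneg_of_mul_nonneg_right h1 (by exact_mod_cast Nat.pos_of_ne_zero hK)
  refine DifferentiableOn.analyticOnNhd (fun z hz => ?_) Metric.isOpen_ball
  obtain ⟨r, hzr, hr1⟩ := exists_between (mem_ball_zero_iff.mp hz)
  have hr0 : 0 < r := (norm_nonneg z).trans_lt hzr
  have hs := (summable_zpow_of_sq_add_sq_le (q := (r : ℂ)) (by exact_mod_cast hr0.ne')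
    (by simpa [abs_of_pos hr0] using hr1) hK hN).norm
  have hd := Complex.differentiableOn_tsum_of_summable_norm (U := Metric.ball (0 : ℂ) r) (F := fun (v : ℤ × ℤ) (w : ℂ) =>
    w ^ (a * v.1 ^ 2 + b * v.1 * v.2 + c * v.2 ^ 2)) hs
    (fun v w _ => (differentiableAt_zpow.mpr (Or.inr (hN0 v))).differentiableWithinAt)
    Metric.isOpen_ball fun v w hw => by
      rw [norm_zpow, norm_zpow, Complex.norm_real, Real.norm_of_nonneg hr0.le]
      exact zpow_le_zpow_left₀ (hN0 v) (norm_nonneg w) (mem_ball_zero_iff.mp hw).le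
  exact (hd.differentiableAt (Metric.isOpen_ball.mem_nhds (mem_ball_zero_iff.mpr hzr))).differentiableWithinAt

theorem qShiftedFactorial_ofReal (t : ℝ) (n : ℕ) :
    qShiftedFactorial (t : ℂ) t n = ((∏ k ∈ Finset.range n, (1 - t * t ^ k) : ℝ) : ℂ) := by
  simp [qShiftedFactorial]

/-- The terms are nonnegative reals, and the sums are nonzero because G(t)H(t)E(t) = E(t⁵) ≠ 0. -/
theorem exists_rogers_eq_ofReal {t : ℝ} (h0 : 0 < t) (h1 : t < 1) :
    ∃ g h : ℝ, 0 < g ∧ 0 < h ∧ rogersG t = g ∧ rogersH t = h := by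
  have hpos : ∀ n : ℕ, 0 ≤ ∏ k ∈ Finset.range n, (1 - t * t ^ k) := fun n =>
    Finset.prod_nonneg fun k _ => by
      rw [← pow_succ']
      exact sub_nonneg.mpr (pow_le_one₀ h0.le h1.le)
  have hG : rogersG t
      = ((∑' n : ℕ, t ^ (n ^ 2) / ∏ k ∈ Finset.range n, (1 - t * t ^ k) : ℝ) : ℂ) := by
    rw [rogersG, Complex.ofReal_tsum]
    simp_rw [qShiftedFactorial_ofReal]
    push_cast
    rfl
  have hH : rogersH t
      = ((∑' n : ℕ, t ^ (n * (n + 1)) / ∏ k ∈ Finset.range n, (1 - t * t ^ k) : ℝ) : ℂ) := by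
    rw [rogersH, Complex.ofReal_tsum]
    simp_rw [qShiftedFactorial_ofReal]
    push_cast
    rfl
  have ht0 : (t : ℂ) ≠ 0 := by exact_mod_cast h0.ne'
  have ht1 : ‖(t : ℂ)‖ < 1 := by simpa [abs_of_pos h0] using h1
  have hne : rogersG t * rogersH t ≠ 0 := fun h => by
    have h2 := rogersG_mul_rogersH ht0 ht1
    rw [h, zero_mul] at h2
    exact eulerE_ne_zero (pow_ne_zero 5 ht0) (norm_pow_lt_one ht1 (by norm_num)) h2.symm
  refine ⟨_, _, lt_of_le_of_ne (tsum_nonneg fun n => div_nonneg (pow_nonneg h0.le _) (hpos n))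
    fun h => ?_, lt_of_le_of_ne (tsum_nonneg fun n => div_nonneg (pow_nonneg h0.le _) (hpos n))
    fun h => ?_, hG, hH⟩
  · exact left_ne_zero_of_mul hne (by rw [hG, ← h, Complex.ofReal_zero])
  · exact right_ne_zero_of_mul hne (by rw [hH, ← h, Complex.ofReal_zero])

theorem formSeries_1_1_88_sub_ne_zero {t : ℝ} (h0 : 0 < t) (h1 : t < 1) :
    formSeries 1 1 88 t - formSeries 9 3 10 t ≠ 0 := by
  have ht0 : (t : ℂ) ≠ 0 := by exact_mod_cast h0.ne'
  have ht1 : ‖(t : ℂ)‖ < 1 := by simpa [abs_of_pos h0] using h1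
  obtain ⟨g, h, hg, hh, eg, eh⟩ := exists_rogers_eq_ofReal (pow_pos h0 3)
    (pow_lt_one₀ h0.le h1 three_ne_zero)
  obtain ⟨g', h', hg', hh', eg', eh'⟩ := exists_rogers_eq_ofReal (pow_pos h0 117)
    (pow_lt_one₀ h0.le h1 (n := 117) (by norm_num))
  push_cast at eg eh eg' eh'
  rw [formSeries_1_1_88_sub ht0 ht1, eg, eh, eg', eh']
  have hU : (g * g' + t ^ 24 * h * h' : ℂ) ≠ 0 := by
    have : 0 < g * g' + t ^ 24 * h * h' := by positivity
    exact_mod_cast this.ne'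
  exact mul_ne_zero (mul_ne_zero (mul_ne_zero (mul_ne_zero two_ne_zero ht0)
    (eulerE_ne_zero (pow_ne_zero _ ht0) (norm_pow_lt_one ht1 (by norm_num))))
    (eulerE_ne_zero (pow_ne_zero _ ht0) (norm_pow_lt_one ht1 (by norm_num)))) (pow_ne_zero 2 hU)

/-! ### The relation between the two U-functions and the final assembly -/

theorem rogersU_3_13 (q : ℂ) : rogersU 3 13 (q ^ 3)
    = rogersH (q ^ 9) * rogersG (q ^ 39) - q ^ 6 * rogersG (q ^ 9) * rogersH (q ^ 39) := by
  have h : (((13 : ℕ) : ℤ) - ((3 : ℕ) : ℤ)) / 5 = (2 : ℕ) := by norm_num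
  rw [rogersU, if_neg (by norm_num), h, zpow_natCast]
  simp only [← pow_mul, Nat.reduceMul]

theorem rogersU_1_39 (q : ℂ) : rogersU 1 39 (q ^ 3)
    = rogersG (q ^ 3) * rogersG (q ^ 117) + q ^ 24 * rogersH (q ^ 3) * rogersH (q ^ 117) := by
  rw [rogersU, if_pos (by norm_num)]
  simp only [← pow_mul, Nat.reduceMul, Nat.reduceAdd, Nat.reduceDiv]

/-- Both sides times 2q³ equal (1,1,10) − (3,3,4) at q³. -/
theorem eulerE_mul_rogersU {q : ℂ} (hq0 : q ≠ 0) (hq : ‖q‖ < 1) :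
    eulerE (q ^ 9) * eulerE (q ^ 39) * rogersU 3 13 (q ^ 3)
      = eulerE (q ^ 3) * eulerE (q ^ 117) * rogersU 1 39 (q ^ 3) := by
  have h3 := norm_pow_lt_one hq three_ne_zero
  have h30 := pow_ne_zero 3 hq0
  have h := (formSeries_1_1_10_sub_eq_rogers_3_13 h30 h3).symm.trans
    (formSeries_1_1_10_sub_eq_rogers_1_39 h30 h3)
  simp only [← pow_mul, Nat.reduceMul] at h
  rw [rogersU_3_13, rogersU_1_39]
  apply mul_left_cancel₀ (mul_ne_zero two_ne_zero h30)
  linear_combination h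

theorem mainTheorem6 :
    -- the four series identities, on the whole open unit disc, with `Q = q ^ 13`
    (∀ q : ℂ, ‖q‖ < 1 →
      formSeries 2 1 44 q - formSeries 8 1 11 q
        = 2 * q ^ 2 * eulerE (q ^ 9) * eulerE ((q ^ 13) ^ 3)) ∧
    (∀ q : ℂ, ‖q‖ < 1 →
      formSeries 5 3 18 q - formSeries 8 1 11 q
        = 2 * q ^ 5 * eulerE (q ^ 3) * eulerE ((q ^ 13) ^ 9)) ∧
    (∀ q : ℂ, ‖q‖ < 1 →
      formSeries 4 1 22 q - formSeries 10 7 10 q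
        = 2 * q ^ 4 * eulerE (q ^ 9) * eulerE ((q ^ 13) ^ 3) * rogersU 3 13 (q ^ 3) ^ 2) ∧
    (∀ q : ℂ, ‖q‖ < 1 →
      formSeries 1 1 88 q - formSeries 9 3 10 q
        = 2 * q * eulerE (q ^ 3) * eulerE ((q ^ 13) ^ 9) * rogersU 1 39 (q ^ 3) ^ 2) ∧
    -- the denominators of the quotient identity: one has no zero with `0 < ‖q‖ < 1`, the zeros of
    -- the other in the unit disc are isolated and do not accumulate in it
    (∀ q : ℂ, 0 < ‖q‖ → ‖q‖ < 1 →
      formSeries 2 1 44 q - formSeries 8 1 11 q ≠ 0 ∧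
      eulerE (q ^ 9) * eulerE ((q ^ 13) ^ 3) ≠ 0) ∧
    (∀ᶠ q in Filter.codiscreteWithin (Metric.ball (0 : ℂ) 1),
      formSeries 1 1 88 q - formSeries 9 3 10 q ≠ 0) ∧
    -- the quotient identity
    (∀ q : ℂ, 0 < ‖q‖ → ‖q‖ < 1 →
      (formSeries 5 3 18 q - formSeries 8 1 11 q) / (formSeries 2 1 44 q - formSeries 8 1 11 q)
        = q ^ 3 * (eulerE (q ^ 3) * eulerE ((q ^ 13) ^ 9)
            / (eulerE (q ^ 9) * eulerE ((q ^ 13) ^ 3)))) ∧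
    (∀ q : ℂ, 0 < ‖q‖ → ‖q‖ < 1 → formSeries 1 1 88 q - formSeries 9 3 10 q ≠ 0 →
      (formSeries 4 1 22 q - formSeries 10 7 10 q) / (formSeries 1 1 88 q - formSeries 9 3 10 q)
        = (formSeries 5 3 18 q - formSeries 8 1 11 q)
            / (formSeries 2 1 44 q - formSeries 8 1 11 q)) := by
  have hz : ∀ {a b c a' b' c' : ℤ}, formSeries a b c 0 = 1 → formSeries a' b' c' 0 = 1 →
      formSeries a b c 0 - formSeries a' b' c' 0 = 0 := fun h h' => by rw [h, h', sub_self]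
  have h1 : ∀ q : ℂ, ‖q‖ < 1 → formSeries 2 1 44 q - formSeries 8 1 11 q
      = 2 * q ^ 2 * eulerE (q ^ 9) * eulerE ((q ^ 13) ^ 3) := fun q hq => by
    rcases eq_or_ne q 0 with rfl | hq0
    · rw [hz (formSeries_zero formBound_2_1_44) (formSeries_zero formBound_8_1_11)]; simp
    · rw [← pow_mul]; exact formSeries_2_1_44_sub hq0 hq
  have h2 : ∀ q : ℂ, ‖q‖ < 1 → formSeries 5 3 18 q - formSeries 8 1 11 q
      = 2 * q ^ 5 * eulerE (q ^ 3) * eulerE ((q ^ 13) ^ 9) := fun q hq => by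
    rcases eq_or_ne q 0 with rfl | hq0
    · rw [hz (formSeries_zero formBound_5_3_18) (formSeries_zero formBound_8_1_11)]; simp
    · rw [← pow_mul]; exact formSeries_5_3_18_sub hq0 hq
  have h3 : ∀ q : ℂ, ‖q‖ < 1 → formSeries 4 1 22 q - formSeries 10 7 10 q
      = 2 * q ^ 4 * eulerE (q ^ 9) * eulerE ((q ^ 13) ^ 3) * rogersU 3 13 (q ^ 3) ^ 2 :=
    fun q hq => by
    rcases eq_or_ne q 0 with rfl | hq0
    · rw [hz (formSeries_zero formBound_4_1_22) (formSeries_zero formBound_10_7_10)]; simp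
    · rw [← pow_mul, rogersU_3_13]; exact formSeries_4_1_22_sub hq0 hq
  have h4 : ∀ q : ℂ, ‖q‖ < 1 → formSeries 1 1 88 q - formSeries 9 3 10 q
      = 2 * q * eulerE (q ^ 3) * eulerE ((q ^ 13) ^ 9) * rogersU 1 39 (q ^ 3) ^ 2 :=
    fun q hq => by
    rcases eq_or_ne q 0 with rfl | hq0
    · rw [hz (formSeries_zero formBound_1_1_88) (formSeries_zero formBound_9_3_10)]; simp
    · rw [← pow_mul, rogersU_1_39]; exact formSeries_1_1_88_sub hq0 hq
  have hE : ∀ q : ℂ, 0 < ‖q‖ → ‖q‖ < 1 → ∀ m : ℕ, m ≠ 0 → eulerE (q ^ m) ≠ 0 := fun q h0 hq m hm =>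
    eulerE_ne_zero (pow_ne_zero m (norm_pos_iff.mp h0)) (norm_pow_lt_one hq hm)
  refine ⟨h1, h2, h3, h4, fun q h0 hq => ?_, ?_, fun q h0 hq => ?_, fun q h0 hq hne => ?_⟩
  · have hq0 := norm_pos_iff.mp h0
    have e9 := hE q h0 hq 9 (by norm_num)
    have e39 := hE q h0 hq (13 * 3) (by norm_num)
    rw [h1 q hq, ← pow_mul]
    exact ⟨mul_ne_zero (mul_ne_zero (mul_ne_zero two_ne_zero (pow_ne_zero 2 hq0)) e9) e39,
      mul_ne_zero e9 e39⟩
  · have ha := (analyticOnNhd_formSeries two_ne_zero formBound_1_1_88).sub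
      (analyticOnNhd_formSeries two_ne_zero formBound_9_3_10)
    -- Identity theorem on the disc; the difference is not identically zero since it does not vanish
    -- at 1/2.
    refine (ha.eqOn_zero_or_eventually_ne_zero_of_preconnected
      (convex_ball (0 : ℂ) 1).isPreconnected).resolve_left fun h => ?_
    have hhalf : (((1 / 2 : ℝ) : ℂ)) ∈ Metric.ball (0 : ℂ) 1 := by
      rw [mem_ball_zero_iff, Complex.norm_real]; norm_num
    exact formSeries_1_1_88_sub_ne_zero (by norm_num) (by norm_num) (h hhalf)
  · have hq0 := norm_pos_iff.mp h0
    have e9 := hE q h0 hq 9 (by norm_num)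
    have e39 := hE q h0 hq (13 * 3) (by norm_num)
    rw [h1 q hq, h2 q hq, ← pow_mul, ← pow_mul]
    field_simp
  · have hq0 := norm_pos_iff.mp h0
    have e9 := hE q h0 hq 9 (by norm_num)
    have e39 := hE q h0 hq (13 * 3) (by norm_num)
    have hU := eulerE_mul_rogersU hq0 hq
    have hd : formSeries 2 1 44 q - formSeries 8 1 11 q ≠ 0 := by
      rw [h1 q hq, ← pow_mul]
      exact mul_ne_zero (mul_ne_zero (mul_ne_zero two_ne_zero (pow_ne_zero 2 hq0)) e9) e39
    rw [div_eq_div_iff hne hd, h1 q hq, h2 q hq, h3 q hq, h4 q hq]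
    simp only [← pow_mul, Nat.reduceMul]
    -- After cross-multiplication the claim is 4q⁶(X² − Y²) = 0, where X = Y is `hU`; the
    -- coefficient is the factor X + Y.
    linear_combination 4 * q ^ 6 * (eulerE (q ^ 9) * eulerE (q ^ 39) * rogersU 3 13 (q ^ 3)
      + eulerE (q ^ 3) * eulerE (q ^ 117) * rogersU 1 39 (q ^ 3)) * hU
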